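/- Let $p$ be a prime, let $K$ be an unramified finite extension of $\mathbb{Q}_p$ with residue field $\mathbb{F}_q$ and ring of integers $\mathcal{O}_K$, let $m\ge 1$, and put $\mathcal{O}_m=\mathcal{O}_K/(p^m)$. Let $f\in\mathbb{F}_q[x_1,\dots,x_n]$ have total degree $d$ (with $d=0$ if $f=0$), and let $X$ be the hypersurface $f=0$ in the torus $\mathbb{G}_m^n$ over $\mathbb{F}_q$. For $Y=X$ and $Y=\mathbb{G}_m^n$ let $$Z(Y,T)=\exp\Big(\sum_{k\ge 1}\frac{\#Y(\mathbb{F}_{q^k})}{k}T^k\Big).$$ Let $\tilde f\in\mathcal{O}_m[x_1,\dots,x_n]$ be any lift of $f$, that is, any polynomial whose reduction modulo $p$ is $f$. Let $R_{m,d}$ be the free $\mathcal{O}_m$-module of polynomials in $\mathcal{O}_m[x_1,\dots,x_n]$ of total degree at most $dp^{m-1}$. Let $\psi_q$ be the $\mathcal{O}_m$-linear operator on $\mathcal{O}_m[x_1,\dots,x_n]$ that sends a monomial $x^u$ to $x^{u/q}$ if $q$ divides every entry of $u$, and to $0$ otherwise. The operator $\psi_q\circ\tilde f^{(q-1)p^{m-1}}$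 (multiplication by $\tilde f^{(q-1)p^{m-1}}$ followed by $\psi_q$) maps $R_{m,d}$ to itself. Then $Z(X,T)$ and $Z(\mathbb{G}_m^n,T)$ are invertible elements of $\mathbb{Z}[[T]]$, and $$\left(\frac{Z(X,T)}{Z(\mathbb{G}_m^n,T)}\right)^{(-1)^n}\equiv\prod_{i=0}^n\det\big(I-q^i(\psi_q\circ\tilde f^{(q-1)p^{m-1}})T\,\big|\,R_{m,d}\big)^{(-1)^i\binom{n}{i}}\pmod{p^m},$$ meaning that the image of the left side in $\mathcal{O}_m[[T]]$ under $\mathbb{Z}\to\mathcal{O}_m$ equals the right side, whose factors are invertible in $\mathcal{O}_m[[T]]$ because their constant terms are $1$. -/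

import Mathlib

noncomputable section

namespace WanZeta

/-! ### The `p`-adic coefficient rings -/

/-- The ring of integers `O_K` of a finite extension `K` of `ℚ_p`. -/
abbrev IntegerRing (p : ℕ) [Fact p.Prime] (K : Type*) [Field K] [Algebra ℤ_[p] K] :
    Subalgebra ℤ_[p] K :=
  integralClosure ℤ_[p] K

/-- The residue class ring `O_m = O_K / (p ^ m)`. -/
abbrev ResidueRing (p : ℕ) [Fact p.Prime] (K : Type*) [Field K] [Algebra ℤ_[p] K] (m : ℕ) :
    Type _ :=
  IntegerRing p K ⧸ Ideal.span {(p : IntegerRing p K) ^ m}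

/-- For `m > 0`, the reduction map `O_m = O_K / (p ^ m) → O_K / (p) ≃ 𝔽_q`. -/
def reduction {p : ℕ} [Fact p.Prime] {K : Type*} [Field K] [Algebra ℤ_[p] K]
    {Fq : Type*} [Field Fq]
    (e : (IntegerRing p K ⧸ Ideal.span {(p : IntegerRing p K)}) ≃+* Fq)
    {m : ℕ} (hm : 0 < m) : ResidueRing p K m →+* Fq :=
  e.toRingHom.comp <| Ideal.Quotient.factor <|
    Ideal.span_singleton_le_span_singleton.mpr (dvd_pow_self _ hm.ne')

/-! ### Zeta functions -/

/-- The zeta function `exp (∑_{k ≥ 1} N_k T ^ k / k)` attached to a sequence of point counts. -/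
def zetaOfCounts (N : ℕ+ → ℕ) : PowerSeries ℚ :=
  (PowerSeries.exp ℚ).subst
    (PowerSeries.X * PowerSeries.mk fun k : ℕ => (N k.succPNat : ℚ) / (k + 1 : ℚ))

/-- The number of points with coordinates in the degree `k` extension of `Fq` on the hypersurface
`f = 0` in the torus `𝔾_m ^ n`. -/
def hypersurfaceCount (p : ℕ) [Fact p.Prime] {Fq : Type*} [Field Fq] [Finite Fq] [CharP Fq p]
    {n : ℕ} (f : MvPolynomial (Fin n) Fq) (k : ℕ+) : ℕ :=
  Nat.card {x : Fin n → (FiniteField.Extension Fq p k)ˣ //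
    MvPolynomial.aeval (fun j => (x j : FiniteField.Extension Fq p k)) f = 0}

/-- The number of points of the torus `𝔾_m ^ n` in the degree `k` extension of `Fq`. -/
def torusCount (p : ℕ) [Fact p.Prime] (Fq : Type*) [Field Fq] [Finite Fq] [CharP Fq p]
    (n : ℕ) (k : ℕ+) : ℕ :=
  Nat.card (Fin n → (FiniteField.Extension Fq p k)ˣ)

/-! ### The operator `ψ_q ∘ f ^ a` -/

section Operator

variable {A : Type*} [CommRing A] {n : ℕ}

/-- The `A`-linear operator on `A[x_1, …, x_n]` that sends `x ^ u` to `x ^ (u / q)` if `q` divides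
every entry of `u`, and to `0` otherwise. -/
def psi (A : Type*) [CommRing A] (n q : ℕ) :
    MvPolynomial (Fin n) A →ₗ[A] MvPolynomial (Fin n) A := by
  classical exact
  (MvPolynomial.basisMonomials (Fin n) A).constr A fun u =>
    if ∀ j, q ∣ u j then MvPolynomial.monomial (u.mapRange (· / q) (Nat.zero_div q)) 1 else 0

theorem psi_monomial (q : ℕ) (u : Fin n →₀ ℕ) [Decidable (∀ j, q ∣ u j)] (a : A) :
    psi A n q (MvPolynomial.monomial u a) =
      if ∀ j, q ∣ u j then MvPolynomial.monomial (u.mapRange (· / q) (Nat.zero_div q)) a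
      else 0 := by
  classical
  have h : MvPolynomial.monomial u a = a • MvPolynomial.basisMonomials (Fin n) A u := by
    simp [MvPolynomial.smul_monomial]
  rw [h, map_smul, psi, Module.Basis.constr_basis]
  split_ifs <;> simp [MvPolynomial.smul_monomial]

theorem coeff_psi {q : ℕ} (hq : 0 < q) (g : MvPolynomial (Fin n) A) (v : Fin n →₀ ℕ) :
    (psi A n q g).coeff v = g.coeff (q • v) := by
  classical
  induction g using MvPolynomial.induction_on' with
  | add g₁ g₂ h₁ h₂ => simp [h₁, h₂]
  | monomial u a =>
    rw [psi_monomial, MvPolynomial.coeff_monomial]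
    by_cases h : u = q • v
    · subst h
      have hv : (q • v).mapRange (· / q) (Nat.zero_div q) = v := by
        ext j; simp [Nat.mul_div_cancel_left _ hq]
      rw [if_pos (fun j => by simp), hv]
      simp
    · rw [if_neg h]
      split_ifs with hd
      · rw [MvPolynomial.coeff_monomial, if_neg]
        rintro rfl
        apply h
        ext j
        simp [Nat.mul_div_cancel' (hd j)]
      · simp

/-- The operator `ψ_q ∘ f ^ a`, where `f ^ a` stands for multiplication by `f ^ a`. -/
def psiMul (q a : ℕ) (F : MvPolynomial (Fin n) A) :
    MvPolynomial (Fin n) A →ₗ[A] MvPolynomial (Fin n) A :=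
  psi A n q ∘ₗ LinearMap.mulLeft A (F ^ a)

theorem exists_lift_totalDegree_le {k : Type*} [CommRing k] (r : A →+* k) {p : ℕ}
    (hr : ∀ a, r a = 0 → (p : A) ∣ a) (F : MvPolynomial (Fin n) A) :
    ∃ G : MvPolynomial (Fin n) A,
      G.totalDegree ≤ (MvPolynomial.map r F).totalDegree ∧
        (p : MvPolynomial (Fin n) A) ∣ F - G := by
  classical
  set d := (MvPolynomial.map r F).totalDegree with hd
  refine ⟨∑ s ∈ F.support with (s.sum fun _ e => e) ≤ d, MvPolynomial.monomial s (F.coeff s),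
    MvPolynomial.totalDegree_finsetSum_le fun s hs => ?_, ?_⟩
  · exact (MvPolynomial.totalDegree_monomial_le _ _).trans (Finset.mem_filter.mp hs).2
  · rw [← map_natCast (MvPolynomial.C (σ := Fin n) (R := A)), MvPolynomial.C_dvd_iff_dvd_coeff]
    intro u
    rw [MvPolynomial.coeff_sub, MvPolynomial.coeff_sum]
    simp only [MvPolynomial.coeff_monomial, Finset.sum_ite_eq', Finset.mem_filter,
      MvPolynomial.mem_support_iff]
    by_cases h0 : F.coeff u = 0
    · simp [h0]
    · by_cases hu : (u.sum fun _ e => e) ≤ d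
      · simp [h0, hu]
      · simp only [hu, and_false, if_false, sub_zero]
        apply hr
        rw [← MvPolynomial.coeff_map]
        by_contra hne
        exact hu (MvPolynomial.le_totalDegree (MvPolynomial.mem_support_iff.mpr hne))

/-- The operator `ψ_q ∘ F ^ ((q - 1) p ^ (m - 1))` maps polynomials of degree at most
`d p ^ (m - 1)` to such polynomials; here `F` is any lift, modulo `p ^ m`, of a polynomial of total
degree `d` modulo `p`. -/
theorem psiMul_mem {k : Type*} [CommRing k] (r : A →+* k) {p m q : ℕ} (hm : 0 < m) (hq : 0 < q)
    (hr : ∀ a, r a = 0 → (p : A) ∣ a) (hp : (p : A) ^ m = 0)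
    {F : MvPolynomial (Fin n) A} {f : MvPolynomial (Fin n) k} (hF : MvPolynomial.map r F = f) :
    ∀ g ∈ MvPolynomial.restrictTotalDegree (Fin n) A (f.totalDegree * p ^ (m - 1)),
      psiMul q ((q - 1) * p ^ (m - 1)) F g ∈
        MvPolynomial.restrictTotalDegree (Fin n) A (f.totalDegree * p ^ (m - 1)) := by
  intro g hg
  obtain ⟨G, hG, hFG⟩ := exists_lift_totalDegree_le r hr F
  rw [hF] at hG
  have hpow : F ^ p ^ (m - 1) = G ^ p ^ (m - 1) := by
    have h := dvd_sub_pow_of_dvd_sub hFG (m - 1)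
    rw [Nat.sub_add_cancel hm, ← map_natCast (MvPolynomial.C (σ := Fin n) (R := A)),
      ← map_pow, hp, map_zero, zero_dvd_iff, sub_eq_zero] at h
    exact h
  rw [MvPolynomial.mem_restrictTotalDegree] at hg ⊢
  set N := f.totalDegree * p ^ (m - 1) with hN
  have hdeg : (F ^ ((q - 1) * p ^ (m - 1)) * g).totalDegree ≤ q * N := by
    rw [mul_comm (q - 1), pow_mul, hpow, ← pow_mul]
    calc _ ≤ _ := MvPolynomial.totalDegree_mul _ _
      _ ≤ (p ^ (m - 1) * (q - 1)) * f.totalDegree + N :=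
        add_le_add ((MvPolynomial.totalDegree_pow _ _).trans (Nat.mul_le_mul_left _ hG)) hg
      _ = (q - 1 + 1) * N := by rw [hN]; ring
      _ = q * N := by rw [Nat.sub_add_cancel hq]
  rw [MvPolynomial.totalDegree, Finset.sup_le_iff]
  intro v hv
  rw [MvPolynomial.mem_support_iff, psiMul, LinearMap.comp_apply, LinearMap.mulLeft_apply,
    coeff_psi hq] at hv
  have h := (MvPolynomial.le_totalDegree (MvPolynomial.mem_support_iff.mpr hv)).trans hdeg
  rw [Finsupp.sum_smul_index' (fun _ => rfl)] at h
  simp only [smul_eq_mul] at h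
  rw [← Finsupp.mul_sum] at h
  exact Nat.le_of_mul_le_mul_left h hq

end Operator

/-- The kernel of the reduction `O_m → 𝔽_q` is generated by `p`. -/
theorem dvd_of_reduction_eq_zero {p : ℕ} [Fact p.Prime] {K : Type*} [Field K] [Algebra ℤ_[p] K]
    {Fq : Type*} [Field Fq]
    (e : (IntegerRing p K ⧸ Ideal.span {(p : IntegerRing p K)}) ≃+* Fq)
    {m : ℕ} (hm : 0 < m) (a : ResidueRing p K m) (ha : reduction e hm a = 0) :
    (p : ResidueRing p K m) ∣ a := by
  obtain ⟨b, rfl⟩ := Ideal.Quotient.mk_surjective a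
  have hb : e (Ideal.Quotient.mk _ b) = 0 := ha
  rw [map_eq_zero_iff e e.injective, Ideal.Quotient.eq_zero_iff_mem,
    Ideal.mem_span_singleton] at hb
  simpa using map_dvd (Ideal.Quotient.mk (Ideal.span {(p : IntegerRing p K) ^ m})) hb

theorem natCast_pow_eq_zero (p : ℕ) [Fact p.Prime] (K : Type*) [Field K] [Algebra ℤ_[p] K]
    (m : ℕ) : (p : ResidueRing p K m) ^ m = 0 := by
  have h : Ideal.Quotient.mk (Ideal.span {(p : IntegerRing p K) ^ m})
      ((p : IntegerRing p K) ^ m) = 0 :=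
    Ideal.Quotient.eq_zero_iff_mem.mpr (Ideal.mem_span_singleton_self _)
  rwa [map_pow, map_natCast] at h

/-! ### `det (I - φ T)` as an invertible power series -/

section Det

variable {A : Type*} [CommRing A] {M : Type*} [AddCommGroup M] [Module A M]
  [Module.Free A M] [Module.Finite A M]

/-- `det (I - φ T | M)` for an endomorphism `φ` of a finite free module `M`, computed in a basis;
`Matrix.charpolyRev B` is `det (1 - T B)`. -/
def detOneSub (φ : Module.End A M) : Polynomial A :=
  (LinearMap.toMatrix (Module.Free.chooseBasis A M) (Module.Free.chooseBasis A M) φ).charpolyRev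

theorem isUnit_detOneSub (φ : Module.End A M) : IsUnit (detOneSub φ : PowerSeries A) := by
  rw [PowerSeries.isUnit_iff_constantCoeff, Polynomial.constantCoeff_coe,
    Polynomial.coeff_zero_eq_eval_zero, detOneSub, Matrix.eval_charpolyRev]
  exact isUnit_one

/-- `det (I - φ T | M)` as an invertible power series: its constant term is `1`. -/
def detUnit (φ : Module.End A M) : (PowerSeries A)ˣ :=
  (isUnit_detOneSub φ).unit

end Det

/-! ### The module `R_{m,d}` and the operator on it -/

section Restricted

variable {A : Type*} [CommRing A] {n : ℕ}

/-- The free `A`-module of polynomials in `n` variables over `A` of total degree at most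
`d p ^ (m - 1)`; for `A = O_m` this is `R_{m,d}`. -/
abbrev RMod (A : Type*) [CommRing A] (n p m d : ℕ) : Submodule A (MvPolynomial (Fin n) A) :=
  MvPolynomial.restrictTotalDegree (Fin n) A (d * p ^ (m - 1))

instance (A : Type*) [CommRing A] (n p m d : ℕ) : Module.Free A (RMod A n p m d) :=
  Module.Free.of_basis (MvPolynomial.basisRestrictSupport _ _)

/-- `det (I - q ^ i (ψ_q ∘ F ^ ((q - 1) p ^ (m - 1))) T | R_{m,d})` as an invertible power series,
for `F` such that the operator maps `R_{m,d}` to itself. -/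
def detFactor {p m d q : ℕ} (F : MvPolynomial (Fin n) A)
    (h : ∀ g ∈ RMod A n p m d, psiMul q ((q - 1) * p ^ (m - 1)) F g ∈ RMod A n p m d) (i : ℕ) :
    (PowerSeries A)ˣ :=
  detUnit ((q : A) ^ i • (psiMul q ((q - 1) * p ^ (m - 1)) F).restrict h)

end Restricted

/-- The operator `ψ_q ∘ F ^ ((q - 1) p ^ (m - 1))` maps `R_{m,d}` to itself, where `q` is the number
of elements of `Fq` and `F` is a lift to `O_m` of a polynomial `f` over `Fq` of total degree `d`. -/
theorem psiMul_stable {p : ℕ} [Fact p.Prime] {K : Type*} [Field K] [Algebra ℤ_[p] K]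
    {Fq : Type*} [Field Fq] [Finite Fq]
    (e : (IntegerRing p K ⧸ Ideal.span {(p : IntegerRing p K)}) ≃+* Fq)
    {n m : ℕ} (hm : 0 < m) {f : MvPolynomial (Fin n) Fq}
    {F : MvPolynomial (Fin n) (ResidueRing p K m)}
    (hF : MvPolynomial.map (reduction e hm) F = f) :
    ∀ g ∈ RMod (ResidueRing p K m) n p m f.totalDegree,
      psiMul (Nat.card Fq) ((Nat.card Fq - 1) * p ^ (m - 1)) F g ∈
        RMod (ResidueRing p K m) n p m f.totalDegree :=
  psiMul_mem (reduction e hm) hm Nat.card_pos (dvd_of_reduction_eq_zero e hm)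
    (natCast_pow_eq_zero p K m) hF

end WanZeta

end

/-! Write q for the cardinality of the residue field and U for the complement of f = 0 in the torus.
Then Z_U Z_X = Z_G, so it suffices to treat Z_U. Enlarge O_K to a local domain V of characteristic
zero that contains all roots of unity and has p in its maximal ideal (`exists_local_extension`).
Reduction identifies the (q^k - 1)-th roots of unity of V with the units of the field with q^k
elements (`exists_rootsOfUnity_equiv`). Torus points over that field thus become the points of
period k of x ↦ x^q on (Vˣ)^n, and Z_U is the zeta function of this dynamical system, weighted by 1
over U and 0 over X.

Now use another weight, H = G^((q-1)p^(m-1)), with G a lift of f of degree at most d. Orthogonality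
of characters gives Dwork's trace formula (`orbitSum_powMap`): the weighted sum over points of
period k is (q^k - 1)^n Tr((ψ_q ∘ H)^k). Expanding the binomial, the zeta function of this weight is
the alternating product of determinants, up to the sign of the exponent (`logD_altProd`).

The two weights have products along every closed orbit that agree modulo p^m (`mk_trajProd_eq`).
Congruent orbit sums would not be enough, since recovering coefficients from a logarithmic
derivative divides by k. Instead both zeta functions are Euler products over orbits, and these agree
factor by factor (`exists_eulerProduct`, `mapUnits_eq_of_trajProd_eq`). Exact identities in
characteristic zero are checked on T u'/u together with the constant term. Finally O_m → V/(p^m) is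
injective, so the congruence descends. -/

noncomputable section

namespace WanZeta
open PowerSeries

/-! ### Logarithmic derivatives of invertible power series -/

section LogDerivative

variable {B C : Type*} [CommRing B] [CommRing C]

/-- The logarithmic derivative `T u' / u` of an invertible power series. -/
def logD (u : B⟦X⟧ˣ) : B⟦X⟧ :=
  X * d⁄dX B (u : B⟦X⟧) * ((u⁻¹ : B⟦X⟧ˣ) : B⟦X⟧)

theorem logD_mul_self (u : B⟦X⟧ˣ) : logD u * (u : B⟦X⟧) = X * d⁄dX B (u : B⟦X⟧) := by
  simp [logD, mul_assoc]

theorem logD_eq_of_mul_self {u : B⟦X⟧ˣ} {s : B⟦X⟧} (h : s * (u : B⟦X⟧) = X * d⁄dX B (u : B⟦X⟧)) :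
    logD u = s := by
  rw [logD, ← h, mul_assoc, Units.mul_inv, mul_one]

theorem logD_mul (u v : B⟦X⟧ˣ) : logD (u * v) = logD u + logD v := by
  apply logD_eq_of_mul_self
  have h1 := logD_mul_self u
  have h2 := logD_mul_self v
  rw [Units.val_mul, Derivation.leibniz]
  simp only [smul_eq_mul]
  linear_combination (v : B⟦X⟧) * h1 + (u : B⟦X⟧) * h2

theorem logD_one : logD (1 : B⟦X⟧ˣ) = 0 := by
  simp [logD]

/-- The logarithmic derivative as a homomorphism. -/
def logDHom (B : Type*) [CommRing B] : B⟦X⟧ˣ →* Multiplicative B⟦X⟧ where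
  toFun u := Multiplicative.ofAdd (logD u)
  map_one' := by rw [logD_one]; rfl
  map_mul' u v := by rw [logD_mul]; rfl

theorem logD_zpow (u : B⟦X⟧ˣ) (z : ℤ) : logD (u ^ z) = z • logD u :=
  congrArg Multiplicative.toAdd (map_zpow (logDHom B) u z)

theorem logD_inv (u : B⟦X⟧ˣ) : logD u⁻¹ = -logD u :=
  congrArg Multiplicative.toAdd (map_inv (logDHom B) u)

theorem logD_prod {ι : Type*} (s : Finset ι) (u : ι → B⟦X⟧ˣ) :
    logD (∏ i ∈ s, u i) = ∑ i ∈ s, logD (u i) :=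
  (congrArg Multiplicative.toAdd (map_prod (logDHom B) u s)).trans (toAdd_prod _ _)

/-- The map on invertible power series induced by a ring homomorphism. -/
abbrev mapUnits (α : B →+* C) : B⟦X⟧ˣ →* C⟦X⟧ˣ :=
  Units.map (PowerSeries.map α).toMonoidHom

theorem logD_map (α : B →+* C) (u : B⟦X⟧ˣ) :
    logD (mapUnits α u) = PowerSeries.map α (logD u) := by
  apply logD_eq_of_mul_self
  have h := congrArg (PowerSeries.map α) (logD_mul_self u)
  have hd : PowerSeries.map α (d⁄dX B (u : B⟦X⟧)) = d⁄dX C (PowerSeries.map α u) := by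
    ext k
    simp [coeff_derivative]
  rw [map_mul, map_mul, hd, PowerSeries.map_X] at h
  exact h

variable [NoZeroDivisors B] [CharZero B]

/-- Coefficient i of T u' = (T u'/u) · u reads i · u_i = 0, and i can be cancelled in a domain of
characteristic zero. -/
theorem coeff_eq_zero_of_coeff_logD_eq_zero {u : B⟦X⟧ˣ} {N : ℕ}
    (h : ∀ k ≤ N, coeff k (logD u) = 0) {i : ℕ} (hi : i ≤ N) (hi0 : i ≠ 0) :
    coeff i (u : B⟦X⟧) = 0 := by
  have h1 := congrArg (coeff i) (logD_mul_self u)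
  obtain ⟨j, rfl⟩ := Nat.exists_eq_succ_of_ne_zero hi0
  rw [coeff_succ_X_mul, coeff_derivative, coeff_mul, Finset.sum_eq_zero] at h1
  · have : (j : B) + 1 ≠ 0 := by exact_mod_cast Nat.succ_ne_zero j
    exact (mul_eq_zero.mp h1.symm).resolve_right this
  · intro x hx
    rw [h _ (by have := Finset.HasAntidiagonal.mem_antidiagonal.mp hx; omega), zero_mul]

/-- The first coefficients of an invertible power series are determined by those of its logarithmic
derivative and the constant term. -/
theorem coeff_eq_of_coeff_logD_eq {u v : B⟦X⟧ˣ} {N : ℕ}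
    (hu : constantCoeff (u : B⟦X⟧) = 1) (hv : constantCoeff (v : B⟦X⟧) = 1)
    (h : ∀ k ≤ N, coeff k (logD u) = coeff k (logD v)) {i : ℕ} (hi : i ≤ N) :
    coeff i (u : B⟦X⟧) = coeff i (v : B⟦X⟧) := by
  set w := u * v⁻¹ with hw
  have huw : (u : B⟦X⟧) = v * w := by rw [hw, ← Units.val_mul]; congr 1; rw [mul_comm u, mul_inv_cancel_left]
  have hw0 : constantCoeff (w : B⟦X⟧) = 1 := by
    have := congrArg constantCoeff huw
    rwa [map_mul, hu, hv, one_mul, eq_comm] at this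
  have hwk : ∀ k ≤ N, coeff k (logD w) = 0 := by
    intro k hk
    rw [hw, logD_mul, logD_inv, map_add, map_neg, h k hk, add_neg_cancel]
  rw [huw, coeff_mul, Finset.sum_eq_single (i, 0)]
  · simp [hw0]
  · rintro ⟨a, b⟩ hab hne
    have hb : b ≠ 0 := by
      rintro rfl
      simp at hab
      exact hne (by simp [hab])
    have hle : a + b = i := Finset.HasAntidiagonal.mem_antidiagonal.mp hab
    rw [coeff_eq_zero_of_coeff_logD_eq_zero hwk (by omega) hb,
      mul_zero]
  · simp

theorem eq_of_logD_eq {u v : B⟦X⟧ˣ}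
    (hu : constantCoeff (u : B⟦X⟧) = 1) (hv : constantCoeff (v : B⟦X⟧) = 1)
    (h : logD u = logD v) : u = v :=
  Units.ext <| PowerSeries.ext fun i =>
    coeff_eq_of_coeff_logD_eq hu hv (N := i) (fun _ _ => by rw [h]) le_rfl

end LogDerivative

/-! ### Euler factors -/

/-- The power series `∑_{k ≥ 1} s_k T ^ k`. -/
def posSeries {B : Type*} [Zero B] (s : ℕ → B) : B⟦X⟧ :=
  PowerSeries.mk fun k => if k = 0 then 0 else s k

section Geometric

variable {B C : Type*} [CommRing B] [CommRing C]

theorem isUnit_one_sub_C_mul_X_pow (a : B) {d : ℕ} (hd : d ≠ 0) :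
    IsUnit (1 - PowerSeries.C a * X ^ d) := by
  rw [PowerSeries.isUnit_iff_constantCoeff]
  simp [hd]

/-- The Euler factor `(1 - a T ^ d)⁻¹`. -/
def eulerFactor (a : B) {d : ℕ} (hd : d ≠ 0) : B⟦X⟧ˣ :=
  (isUnit_one_sub_C_mul_X_pow a hd).unit⁻¹

theorem mapUnits_eulerFactor (α : B →+* C) (a : B) {d : ℕ} (hd : d ≠ 0) :
    mapUnits α (eulerFactor a hd) = eulerFactor (α a) hd := by
  rw [eulerFactor, map_inv, eulerFactor, inv_inj]
  ext1
  simp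

theorem constantCoeff_inv_eq_one {u : B⟦X⟧ˣ} (hu : constantCoeff (u : B⟦X⟧) = 1) :
    constantCoeff ((u⁻¹ : B⟦X⟧ˣ) : B⟦X⟧) = 1 := by
  have := congrArg constantCoeff (Units.mul_inv u)
  rwa [map_mul, hu, one_mul, map_one] at this

theorem constantCoeff_eulerFactor (a : B) {d : ℕ} (hd : d ≠ 0) :
    constantCoeff (eulerFactor a hd : B⟦X⟧) = 1 :=
  constantCoeff_inv_eq_one (by simp [hd])

/-- This is the geometric series d a T^d / (1 - a T^d), checked after clearing the denominator. -/
theorem logD_eulerFactor (a : B) {d : ℕ} (hd : d ≠ 0) :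
    logD (eulerFactor a hd) = posSeries fun k => if d ∣ k then d * a ^ (k / d) else 0 := by
  rw [eulerFactor, logD_inv, neg_eq_iff_eq_neg]
  apply logD_eq_of_mul_self
  have hder : X * d⁄dX B (1 - PowerSeries.C a * X ^ d : B⟦X⟧) = - (PowerSeries.C (d * a) * X ^ d) := by
    obtain ⟨e, rfl⟩ := Nat.exists_eq_succ_of_ne_zero hd
    simp only [map_sub, Derivation.leibniz, derivative_pow, derivative_X, derivative_C,
      smul_eq_mul, map_mul, derivative_one]
    simp
    ring
  rw [IsUnit.unit_spec, hder, neg_mul, neg_inj, mul_sub, mul_one, mul_left_comm, sub_eq_iff_eq_add]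
  ext k
  rw [map_add, coeff_C_mul, coeff_C_mul, coeff_mul_X_pow', coeff_X_pow]
  simp only [posSeries, coeff_mk]
  rcases lt_trichotomy k d with h | rfl | h
  · rw [if_neg h.ne, if_neg h.not_ge]
    split_ifs with h0 h1
    · simp
    · exact absurd (Nat.le_of_dvd (Nat.pos_of_ne_zero h0) h1) h.not_ge
    · simp
  · simp [hd, Nat.div_self (Nat.pos_of_ne_zero hd)]
  · have hk : k ≠ 0 := by omega
    have hkd : k - d ≠ 0 := by omega
    have hiff : d ∣ k - d ↔ d ∣ k := Nat.dvd_sub_self_right.trans (by simp [h.not_ge])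
    simp only [hiff, if_neg h.ne', if_pos h.le, if_neg hk, if_neg hkd]
    split_ifs with h1
    · obtain ⟨c, rfl⟩ := h1
      obtain ⟨e, rfl⟩ : ∃ e, c = e + 1 := Nat.exists_eq_succ_of_ne_zero (by rintro rfl; simp at hk)
      have hp := Nat.pos_of_ne_zero hd
      rw [show d * (e + 1) - d = d * e by rw [mul_add, mul_one, Nat.add_sub_cancel],
        Nat.mul_div_cancel_left _ hp, Nat.mul_div_cancel_left _ hp]
      ring
    · simp

end Geometric

/-! ### Reversed characteristic polynomials and traces of powers -/

section Determinant

variable {S : Type*} [CommRing S] {ι : Type*} [Fintype ι] [DecidableEq ι]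

open Polynomial in
/-- Jacobi's formula for the derivative of a determinant. -/
theorem derivative_det (A : Matrix ι ι S[X]) :
    derivative A.det = (A.adjugate * A.map derivative).trace := by
  -- By Cramer's rule each diagonal entry is the determinant with one column differentiated; what
  -- remains is the product rule in the Leibniz expansion.
  have h1 : ∀ i, (A.adjugate * A.map derivative) i i =
      (A.updateCol i fun j => derivative (A j i)).det := by
    intro i
    rw [← Matrix.cramer_apply, Matrix.cramer_eq_adjugate_mulVec]
    rfl
  rw [Matrix.trace, Finset.sum_congr rfl fun i _ => (Matrix.diag_apply _ i).trans (h1 i)]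
  simp only [Matrix.det_apply, map_sum]
  rw [Finset.sum_comm]
  refine Finset.sum_congr rfl fun σ _ => ?_
  rw [Units.smul_def, map_zsmul, derivative_prod_finset, Finset.smul_sum]
  refine Finset.sum_congr rfl fun i _ => ?_
  rw [Units.smul_def, ← Finset.mul_prod_erase _ _ (Finset.mem_univ i), Matrix.updateCol_self,
    mul_comm]
  congr 2
  refine Finset.prod_congr rfl fun j hj => ?_
  rw [Matrix.updateCol_ne (Finset.ne_of_mem_erase hj)]

/-- Apply Jacobi's formula to 1 - T M, whose derivative is -M. Its inverse over power series is R =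
∑ M^k T^k, so its adjugate is det · R, and T u'/u = -Tr(T R M). -/
theorem logD_charpolyRev (M : Matrix ι ι S) (u : S⟦X⟧ˣ) (hu : (u : S⟦X⟧) = M.charpolyRev) :
    logD u = -posSeries fun k => (M ^ k).trace := by
  apply logD_eq_of_mul_self
  set A : Matrix ι ι (Polynomial S) :=
    1 - (Polynomial.X : Polynomial S) • M.map Polynomial.C with hA
  have hdet : M.charpolyRev = A.det := rfl
  have hder : A.map Polynomial.derivative = -M.map Polynomial.C := by
    ext1 i j
    by_cases hij : i = j <;> simp [hA, hij]
  let φ : Polynomial S →+* S⟦X⟧ := Polynomial.coeToPowerSeries.ringHom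
  let R : Matrix ι ι S⟦X⟧ := Matrix.of fun i j => PowerSeries.mk fun k => (M ^ k) i j
  have hA' : A.map φ = 1 - (X : S⟦X⟧) • M.map (PowerSeries.C (R := S)) := by
    ext1 i j
    by_cases hij : i = j <;> simp [hA, φ, hij, mul_comm (X : S⟦X⟧)]
  have hR : A.map φ * R = 1 := by
    rw [hA']
    ext i j k
    rw [sub_mul, one_mul, Matrix.sub_apply, Matrix.smul_mul, Matrix.smul_apply, Matrix.mul_apply,
      smul_eq_mul, map_sub]
    rcases k with _ | k
    · by_cases hij : i = j <;> simp [R, Matrix.one_apply, hij]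
    · rw [coeff_succ_X_mul, map_sum]
      simp only [R, Matrix.of_apply, Matrix.map_apply, coeff_C_mul, coeff_mk]
      rw [← Matrix.mul_apply, ← pow_succ']
      by_cases hij : i = j <;> simp [Matrix.one_apply, hij, coeff_one]
  have hadj : (A.map φ).adjugate = (A.map φ).det • R := by
    calc _ = (A.map φ).adjugate * (A.map φ * R) := by rw [hR, mul_one]
      _ = _ := by rw [← mul_assoc, Matrix.adjugate_mul, Matrix.smul_mul, one_mul]
  have hu' : (u : S⟦X⟧) = (A.map φ).det := by
    rw [hu, hdet, ← RingHom.mapMatrix_apply, ← RingHom.map_det]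
    rfl
  have hd : d⁄dX S (u : S⟦X⟧) = -((A.map φ).adjugate * M.map (PowerSeries.C (R := S))).trace := by
    rw [hu, derivative_coe, hdet, derivative_det, hder, mul_neg, Matrix.trace_neg]
    rw [← Polynomial.coeToPowerSeries.ringHom_apply]
    change φ _ = _
    rw [map_neg, neg_inj, AddMonoidHom.map_trace φ]
    congr 1
    rw [← RingHom.mapMatrix_apply, map_mul, RingHom.mapMatrix_apply, ← RingHom.mapMatrix_apply,
      RingHom.map_adjugate, RingHom.mapMatrix_apply]
    congr 1
    ext1 i j
    simp [φ]
  rw [hd, hadj, ← hu', Matrix.smul_mul, Matrix.trace_smul, smul_eq_mul, neg_mul, mul_neg, neg_inj,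
    mul_left_comm, mul_comm]
  congr 1
  ext k
  rcases k with _ | k
  · simp [posSeries]
  · rw [coeff_succ_X_mul]
    simp only [posSeries, coeff_mk, Nat.succ_ne_zero, if_false, Matrix.trace, map_sum,
      Matrix.diag_apply, Matrix.mul_apply, pow_succ, R, Matrix.of_apply, Matrix.map_apply]
    refine Finset.sum_congr rfl fun i _ => Finset.sum_congr rfl fun j _ => ?_
    rw [coeff_mul_C, coeff_mk]

end Determinant
end WanZeta

namespace WanZeta
open PowerSeries

/-! ### Weighted periodic orbits and their Euler products -/

section PeriodicProducts

variable {M : Type*} [CommMonoid M]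

theorem prod_range_shift_of_periodic {g : ℕ → M} {d : ℕ} (hg : ∀ i, g (i + d) = g i) (j : ℕ) :
    ∏ i ∈ Finset.range d, g (i + j) = ∏ i ∈ Finset.range d, g i := by
  induction j with
  | zero => simp
  | succ j ih =>
    rw [← ih]
    rcases d with _ | d
    · simp
    · rw [Finset.prod_range_succ, Finset.prod_range_succ']
      congr 1
      · refine Finset.prod_congr rfl fun i _ => ?_
        congr 1; ring
      · rw [zero_add, ← hg j]; congr 1; ring

theorem prod_range_mul_of_periodic {g : ℕ → M} {d : ℕ} (hg : ∀ i, g (i + d) = g i) (e : ℕ) :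
    ∏ i ∈ Finset.range (d * e), g i = (∏ i ∈ Finset.range d, g i) ^ e := by
  induction e with
  | zero => simp
  | succ e ih =>
    rw [mul_add, mul_one, Finset.prod_range_add, ih, pow_succ]
    congr 1
    rw [← prod_range_shift_of_periodic hg (d * e)]
    exact Finset.prod_congr rfl fun i _ => by rw [add_comm]

end PeriodicProducts

section Orbits

variable {P : Type*} (φ : P → P) {B B' C : Type*} [CommRing B] [CommRing B'] [CommRing C]

/-- The product of a weight along the first `k` points of a trajectory. -/
def trajProd (w : P → B) (k : ℕ) (x : P) : B :=
  ∏ j ∈ Finset.range k, w (φ^[j] x)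

/-- The sum over the fixed points of `φ ^ k` of the products of a weight along their orbits. -/
def orbitSum (w : P → B) (k : ℕ) : B :=
  ∑ᶠ x ∈ Function.ptsOfPeriod φ k, trajProd φ w k x

open Classical in
/-- The part of `orbitSum` that comes from a finite set of points. -/
def orbitSumOn (s : Finset P) (w : P → B) (k : ℕ) : B :=
  ∑ x ∈ s with φ^[k] x = x, trajProd φ w k x

variable {φ}

/-- The trajectory runs k/d times around a cycle of length d, and a product around a cycle does not
depend on the starting point. If d = 0 (x not periodic), then k = 0 and both sides are 1. -/
theorem trajProd_iterate_of_dvd (w : P → B) (x : P) (j : ℕ) {k : ℕ}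
    (hk : Function.minimalPeriod φ x ∣ k) :
    trajProd φ w k (φ^[j] x) =
      trajProd φ w (Function.minimalPeriod φ x) x ^ (k / Function.minimalPeriod φ x) := by
  have hper : ∀ i, w (φ^[i + Function.minimalPeriod φ x] x) = w (φ^[i] x) := fun i => by
    rw [Function.iterate_add_minimalPeriod_eq]
  rcases Nat.eq_zero_or_pos (Function.minimalPeriod φ x) with h0 | h0
  · rw [h0, zero_dvd_iff] at hk
    simp [trajProd, hk]
  obtain ⟨e, rfl⟩ := hk
  rw [Nat.mul_div_cancel_left _ h0]
  simp only [trajProd, ← Function.iterate_add_apply]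
  have hper' : ∀ i, w (φ^[i + Function.minimalPeriod φ x * e] x) = w (φ^[i] x) := by
    intro i
    rw [Function.iterate_add_apply,
      (Function.isPeriodicPt_iff_minimalPeriod_dvd.mpr (dvd_mul_right _ e)).eq]
  rw [prod_range_shift_of_periodic (g := fun i => w (φ^[i] x)) hper',
    prod_range_mul_of_periodic (g := fun i => w (φ^[i] x)) hper]

open Classical in
/-- The contribution of a single orbit. -/
theorem orbitSumOn_orbit (w : P → B) (x : P) (k : ℕ) :
    orbitSumOn φ ((Finset.range (Function.minimalPeriod φ x)).image fun j => φ^[j] x) w k =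
      if Function.minimalPeriod φ x ∣ k then (Function.minimalPeriod φ x : B) *
        trajProd φ w (Function.minimalPeriod φ x) x ^ (k / Function.minimalPeriod φ x) else 0 := by
  set d := Function.minimalPeriod φ x with hd
  have hfix : ∀ j ∈ Finset.range d, (φ^[k] (φ^[j] x) = φ^[j] x ↔ d ∣ k) := by
    intro j hj
    have hx : x ∈ Function.periodicPts φ :=
      Function.minimalPeriod_pos_iff_mem_periodicPts.mp
        ((Nat.zero_le j).trans_lt (Finset.mem_range.mp hj))
    rw [hd, ← Function.minimalPeriod_apply_iterate hx j]
    exact Function.isPeriodicPt_iff_minimalPeriod_dvd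
  have hinj : Set.InjOn (fun j => φ^[j] x) (Finset.range d : Set ℕ) := by
    intro i hi j hj hij
    exact Function.iterate_injOn_Iio_minimalPeriod (by simpa using hi) (by simpa using hj) hij
  rw [orbitSumOn, Finset.sum_filter, Finset.sum_image hinj]
  split_ifs with hk
  · refine (Finset.sum_congr rfl fun j hj =>
      (if_pos ((hfix j hj).mpr hk)).trans (trajProd_iterate_of_dvd w x j hk)).trans ?_
    rw [Finset.sum_const, Finset.card_range, nsmul_eq_mul]
  · exact Finset.sum_eq_zero fun j hj => if_neg fun h => hk ((hfix j hj).mp h)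

open Classical in
theorem logD_mul_eulerFactor_of_orbit {s : Finset P} {x : P}
    (hx : Function.minimalPeriod φ x ≠ 0)
    (hos : (Finset.range (Function.minimalPeriod φ x)).image (fun j => φ^[j] x) ⊆ s)
    (v : P → B) (Q : B⟦X⟧ˣ)
    (hQ : logD Q = posSeries (orbitSumOn φ
      (s \ (Finset.range (Function.minimalPeriod φ x)).image fun j => φ^[j] x) v)) :
    logD (Q * eulerFactor (trajProd φ v (Function.minimalPeriod φ x) x) hx) =
      posSeries (orbitSumOn φ s v) := by
  have hsplit : ∀ k, orbitSumOn φ s v k =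
      orbitSumOn φ (s \ (Finset.range (Function.minimalPeriod φ x)).image fun j => φ^[j] x) v k +
        orbitSumOn φ ((Finset.range (Function.minimalPeriod φ x)).image fun j => φ^[j] x) v k := by
    intro k
    simp only [orbitSumOn, Finset.sum_filter]
    rw [Finset.sum_sdiff hos]
  rw [logD_mul, hQ, logD_eulerFactor]
  ext k
  simp only [posSeries, map_add, coeff_mk, hsplit k, orbitSumOn_orbit v x k]
  split_ifs <;> simp

open Classical in
/-- The Euler product over the orbits in a finite stable set of periodic points, for two systems of
weights with the same image in a ring `C`. -/
theorem exists_eulerProduct (α : B →+* C) (β : B' →+* C) (w : P → B) (u : P → B')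
    (h : ∀ x, ∀ k > 0, φ^[k] x = x → α (trajProd φ w k x) = β (trajProd φ u k x)) (s : Finset P)
    (hs : ∀ x ∈ s, φ x ∈ s) (hper : ∀ x ∈ s, x ∈ Function.periodicPts φ) :
    ∃ (L : B⟦X⟧ˣ) (L' : B'⟦X⟧ˣ), constantCoeff (L : B⟦X⟧) = 1 ∧ constantCoeff (L' : B'⟦X⟧) = 1 ∧
      logD L = posSeries (orbitSumOn φ s w) ∧ logD L' = posSeries (orbitSumOn φ s u) ∧
      mapUnits α L = mapUnits β L' := by
  -- Remove one orbit at a time. Both weights use the same orbits, so their Euler factors have the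
  -- same image in `C`.
  induction hn : s.card using Nat.strong_induction_on generalizing s with
  | _ n ih =>
  subst hn
  rcases s.eq_empty_or_nonempty with rfl | ⟨x, hx⟩
  · refine ⟨1, 1, by simp, by simp, ?_, ?_, by simp⟩ <;>
    · rw [logD_one]
      ext k
      simp [posSeries, orbitSumOn]
  set d := Function.minimalPeriod φ x with hd
  have hd0 : d ≠ 0 := (Function.minimalPeriod_pos_iff_mem_periodicPts.mpr (hper x hx)).ne'
  set o := (Finset.range d).image fun j => φ^[j] x with ho
  have hmem : ∀ i, φ^[i] x ∈ o := by
    intro i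
    rw [← Function.iterate_mod_minimalPeriod_eq]
    exact Finset.mem_image_of_mem _ (Finset.mem_range.mpr (Nat.mod_lt _ (Nat.pos_of_ne_zero hd0)))
  have hos : o ⊆ s := by
    intro y hy
    obtain ⟨j, -, rfl⟩ := Finset.mem_image.mp hy
    clear hy
    induction j with
    | zero => exact hx
    | succ j ihj => rw [Function.iterate_succ_apply']; exact hs _ ihj
  have hxo : x ∈ o := hmem 0
  obtain ⟨L, L', hL0, hL0', hL, hL', hLL⟩ := ih (s \ o).card
    (Finset.card_lt_card (Finset.sdiff_ssubset hos ⟨x, hxo⟩)) (s \ o)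
    (by
      intro y hy
      rw [Finset.mem_sdiff] at hy ⊢
      refine ⟨hs y hy.1, fun hyo => hy.2 ?_⟩
      obtain ⟨j, -, hj⟩ := Finset.mem_image.mp hyo
      obtain ⟨k, hk, hky⟩ := hper y hy.1
      obtain ⟨k, rfl⟩ := Nat.exists_eq_succ_of_ne_zero hk.ne'
      -- A periodic point y is an iterate of φ y, so φ y cannot enter the removed orbit unless y
      -- already lies in it.
      have : y = φ^[k + j] x := by
        rw [Function.iterate_add_apply]
        rw [hj, ← Function.iterate_succ_apply]
        exact hky.symm
      rw [this]
      exact hmem _)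
    (fun y hy => hper y (Finset.mem_sdiff.mp hy).1) rfl
  refine ⟨L * eulerFactor (trajProd φ w d x) hd0, L' * eulerFactor (trajProd φ u d x) hd0,
    ?_, ?_, logD_mul_eulerFactor_of_orbit hd0 hos w L hL,
    logD_mul_eulerFactor_of_orbit hd0 hos u L' hL', ?_⟩
  · rw [Units.val_mul, map_mul, hL0, constantCoeff_eulerFactor, one_mul]
  · rw [Units.val_mul, map_mul, hL0', constantCoeff_eulerFactor, one_mul]
  · rw [map_mul, map_mul, hLL, mapUnits_eulerFactor, mapUnits_eulerFactor,
      h x d (Nat.pos_of_ne_zero hd0) (Function.iterate_minimalPeriod)]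

/-- All periods k with 0 < k ≤ N divide N!, so one finite stable set contains every point that
matters up to degree N. -/
theorem coeff_posSeries_orbitSumOn (hfin : ∀ k > 0, (Function.ptsOfPeriod φ k).Finite) (v : P → B)
    {N : ℕ} (hN : (Function.ptsOfPeriod φ N.factorial).Finite) {k : ℕ} (hk : k ≤ N) :
    coeff k (posSeries (orbitSumOn φ hN.toFinset v)) = coeff k (posSeries (orbitSum φ v)) := by
  classical
  simp only [posSeries, coeff_mk]
  split_ifs with hk0
  · rfl
  · rw [orbitSum, orbitSumOn, finsum_mem_eq_finite_toFinset_sum _ (hfin k (Nat.pos_of_ne_zero hk0))]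
    refine Finset.sum_congr ?_ fun _ _ => rfl
    ext x
    rw [Finset.mem_filter, Set.Finite.mem_toFinset, Set.Finite.mem_toFinset]
    refine ⟨fun hx => hx.2, fun hx => ⟨?_, hx⟩⟩
    exact Function.IsPeriodicPt.trans_dvd hx (Nat.dvd_factorial (Nat.pos_of_ne_zero hk0) hk)

/-- Approximations of the Euler product over all orbits. -/
theorem exists_eulerProduct_approx (hfin : ∀ k > 0, (Function.ptsOfPeriod φ k).Finite)
    (α : B →+* C) (β : B' →+* C) (w : P → B) (u : P → B')
    (h : ∀ x, ∀ k > 0, φ^[k] x = x → α (trajProd φ w k x) = β (trajProd φ u k x)) (N : ℕ) :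
    ∃ (L : B⟦X⟧ˣ) (L' : B'⟦X⟧ˣ), constantCoeff (L : B⟦X⟧) = 1 ∧ constantCoeff (L' : B'⟦X⟧) = 1 ∧
      (∀ k ≤ N, coeff k (logD L) = coeff k (posSeries (orbitSum φ w))) ∧
      (∀ k ≤ N, coeff k (logD L') = coeff k (posSeries (orbitSum φ u))) ∧
      mapUnits α L = mapUnits β L' := by
  have hN := hfin N.factorial N.factorial_pos
  obtain ⟨L, L', h0, h0', hL, hL', hLL⟩ := exists_eulerProduct α β w u h hN.toFinset
    (by
      intro x hx
      rw [Set.Finite.mem_toFinset, Function.mem_ptsOfPeriod] at hx ⊢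
      exact Function.IsPeriodicPt.apply hx)
    (by
      intro x hx
      rw [Set.Finite.mem_toFinset, Function.mem_ptsOfPeriod] at hx
      exact ⟨_, N.factorial_pos, hx⟩)
  refine ⟨L, L', h0, h0', fun k hk => ?_, fun k hk => ?_, hLL⟩
  · rw [hL, coeff_posSeries_orbitSumOn hfin w hN hk]
  · rw [hL', coeff_posSeries_orbitSumOn hfin u hN hk]

/-- The zeta function attached to a weight is integral. -/
theorem exists_logD_eq_orbitSum [NoZeroDivisors B] [CharZero B]
    (hfin : ∀ k > 0, (Function.ptsOfPeriod φ k).Finite) (w : P → B) :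
    ∃ L : B⟦X⟧ˣ, constantCoeff (L : B⟦X⟧) = 1 ∧ logD L = posSeries (orbitSum φ w) := by
  choose L _ h0 _ hL _ _ using fun N => exists_eulerProduct_approx hfin (RingHom.id B)
    (RingHom.id B) w w (fun _ _ _ _ => rfl) N
  have hcoef : ∀ {i N}, i ≤ N → coeff i (L i : B⟦X⟧) = coeff i (L N : B⟦X⟧) := by
    intro i N hi
    refine coeff_eq_of_coeff_logD_eq (N := i) (h0 _) (h0 _) (fun k hk => ?_) le_rfl
    rw [hL _ k hk, hL _ k (hk.trans hi)]
  -- The diagonal limit of the finite Euler products: by `hcoef`, coefficient i no longer changes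
  -- from the i-th approximation on.
  set Q : B⟦X⟧ := PowerSeries.mk fun i => coeff i (L i : B⟦X⟧) with hQ
  have hQ0 : constantCoeff Q = 1 := by
    rw [← coeff_zero_eq_constantCoeff_apply, hQ, coeff_mk, coeff_zero_eq_constantCoeff_apply, h0]
  have hQu : IsUnit Q := by
    rw [PowerSeries.isUnit_iff_constantCoeff, hQ0]
    exact isUnit_one
  refine ⟨hQu.unit, hQ0, logD_eq_of_mul_self ?_⟩
  ext k
  have h1 := congrArg (coeff k) (logD_mul_self (L k))
  rw [IsUnit.unit_spec]
  have h2 : coeff k (X * d⁄dX B Q) = coeff k (X * d⁄dX B (L k : B⟦X⟧)) := by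
    rcases k with _ | k
    · simp
    · rw [coeff_succ_X_mul, coeff_succ_X_mul, coeff_derivative, coeff_derivative, hQ, coeff_mk]
  rw [h2, ← h1, coeff_mul, coeff_mul]
  refine Finset.sum_congr rfl fun x hx => ?_
  have hx' := Finset.HasAntidiagonal.mem_antidiagonal.mp hx
  rw [hL k _ (by omega), hQ, coeff_mk, hcoef (by omega : x.2 ≤ k)]

/-- Congruent weights have congruent zeta functions. -/
theorem mapUnits_eq_of_trajProd_eq [NoZeroDivisors B] [CharZero B] [NoZeroDivisors B'] [CharZero B']
    (hfin : ∀ k > 0, (Function.ptsOfPeriod φ k).Finite)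
    (α : B →+* C) (β : B' →+* C) {w : P → B} {u : P → B'}
    (h : ∀ x, ∀ k > 0, φ^[k] x = x → α (trajProd φ w k x) = β (trajProd φ u k x))
    {L : B⟦X⟧ˣ} {L' : B'⟦X⟧ˣ} (h0 : constantCoeff (L : B⟦X⟧) = 1)
    (h0' : constantCoeff (L' : B'⟦X⟧) = 1)
    (hL : logD L = posSeries (orbitSum φ w)) (hL' : logD L' = posSeries (orbitSum φ u)) :
    mapUnits α L = mapUnits β L' := by
  ext1
  ext i
  obtain ⟨Q, Q', hQ0, hQ0', hQ, hQ', hQQ⟩ := exists_eulerProduct_approx hfin α β w u h i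
  have h1 : coeff i (L : B⟦X⟧) = coeff i (Q : B⟦X⟧) :=
    coeff_eq_of_coeff_logD_eq h0 hQ0 (fun k hk => by rw [hL, hQ k hk]) le_rfl
  have h2 : coeff i (L' : B'⟦X⟧) = coeff i (Q' : B'⟦X⟧) :=
    coeff_eq_of_coeff_logD_eq h0' hQ0' (fun k hk => by rw [hL', hQ' k hk]) le_rfl
  have h3 := congrArg (fun v : C⟦X⟧ˣ => coeff i (v : C⟦X⟧)) hQQ
  simp only [Units.coe_map, RingHom.toMonoidHom_eq_coe, MonoidHom.coe_coe, coeff_map] at h3 ⊢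
  rw [h1, h2, h3]

end Orbits
end WanZeta

namespace WanZeta
open MvPolynomial

/-! ### The matrix of ψ_q ∘ H in the monomial basis -/

section OperatorMatrix

variable {A B : Type*} [CommRing A] [CommRing B] {n : ℕ}

/-- The exponents of the monomials of degree at most `N`. -/
abbrev Exps (n N : ℕ) : Type := {s : Fin n →₀ ℕ | (s.sum fun _ e => e) ≤ N}

instance (n N : ℕ) : Finite (Exps n N) :=
  (Set.Finite.subset (Finset.finite_toSet
    (Finset.Iic (Finsupp.equivFunOnFinite.symm fun _ : Fin n => N)))
    fun s hs => by
      simp only [Finset.coe_Iic, Set.mem_Iic]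
      intro i
      exact (Finsupp.le_degree i s).trans hs).to_subtype

instance (n N : ℕ) : Fintype (Exps n N) := Fintype.ofFinite _

open Classical in
instance (n N : ℕ) : DecidableEq (Exps n N) := inferInstance

/-- The matrix of the operator `ψ_q ∘ H` on the polynomials of degree at most `N`, in the basis of
monomials. -/
def opMat (q N : ℕ) (H : MvPolynomial (Fin n) A) : Matrix (Exps n N) (Exps n N) A :=
  Matrix.of fun v u => (H * monomial (u : Fin n →₀ ℕ) 1).coeff (q • (v : Fin n →₀ ℕ))

theorem opMat_map (α : A →+* B) (q N : ℕ) (H : MvPolynomial (Fin n) A) :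
    (opMat q N H).map α = opMat q N (map α H) := by
  ext v u
  simp only [opMat, Matrix.map_apply, Matrix.of_apply, ← coeff_map, map_mul, map_monomial, map_one]

/-- The basis of monomials of the polynomials of degree at most `N`. -/
def monomialBasis (A : Type*) [CommRing A] (n N : ℕ) :
    Module.Basis (Exps n N) A (restrictTotalDegree (Fin n) A N) :=
  basisRestrictSupport A _

theorem monomialBasis_repr {N : ℕ} (g : restrictTotalDegree (Fin n) A N) (v : Exps n N) :
    (monomialBasis A n N).repr g v = (g : MvPolynomial (Fin n) A).coeff v :=
  rfl

theorem coe_monomialBasis {N : ℕ} (u : Exps n N) :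
    (monomialBasis A n N u : MvPolynomial (Fin n) A) = monomial (u : Fin n →₀ ℕ) 1 := by
  have hmem : monomial (u : Fin n →₀ ℕ) (1 : A) ∈ restrictTotalDegree (Fin n) A N := by
    rw [mem_restrictTotalDegree]
    exact (totalDegree_monomial_le _ _).trans u.2
  have : monomialBasis A n N u = ⟨_, hmem⟩ := by
    apply (monomialBasis A n N).repr.injective
    rw [Module.Basis.repr_self]
    ext v
    rw [monomialBasis_repr, coeff_monomial, Finsupp.single_apply]
    simp only [Subtype.ext_iff]
  rw [this]

theorem toMatrix_restrict {q N a : ℕ} (hq : 0 < q) (F : MvPolynomial (Fin n) A)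
    (h : ∀ g ∈ restrictTotalDegree (Fin n) A N, psiMul q a F g ∈ restrictTotalDegree (Fin n) A N) :
    LinearMap.toMatrix (monomialBasis A n N) (monomialBasis A n N)
      ((psiMul q a F).restrict h) = opMat q N (F ^ a) := by
  ext v u
  rw [LinearMap.toMatrix_apply, monomialBasis_repr, LinearMap.coe_restrict_apply,
    coe_monomialBasis, psiMul, LinearMap.comp_apply, coeff_psi hq]
  rfl

/-- Both sides are reversals of `LinearMap.charpoly`, which is independent of the basis. -/
theorem detOneSub_eq_charpolyRev [Nontrivial A] {M : Type*} [AddCommGroup M] [Module A M]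
    [Module.Free A M] [Module.Finite A M] {ι : Type*} [Fintype ι] [DecidableEq ι]
    (b : Module.Basis ι A M) (φ : Module.End A M) :
    detOneSub φ = (LinearMap.toMatrix b b φ).charpolyRev := by
  rw [detOneSub, ← Matrix.reverse_charpoly, ← Matrix.reverse_charpoly, LinearMap.charpoly_toMatrix,
    LinearMap.charpoly_toMatrix]

theorem charpolyRev_map {ι : Type*} [Fintype ι] [DecidableEq ι] (α : A →+* B) (M : Matrix ι ι A) :
    (M.map α).charpolyRev = M.charpolyRev.map α := by
  rw [Matrix.charpolyRev, Matrix.charpolyRev, ← Polynomial.coe_mapRingHom, RingHom.map_det]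
  congr 1
  ext1 i j
  by_cases hij : i = j <;> simp [hij]

theorem constantCoeff_charpolyRev {ι : Type*} [Fintype ι] [DecidableEq ι] (M : Matrix ι ι A) :
    PowerSeries.constantCoeff (M.charpolyRev : PowerSeries A) = 1 := by
  rw [Polynomial.constantCoeff_coe, Polynomial.coeff_zero_eq_eval_zero, Matrix.eval_charpolyRev]

/-- `det (1 - T M)` as an invertible power series. -/
def charpolyRevUnit {ι : Type*} [Fintype ι] [DecidableEq ι] (M : Matrix ι ι A) :
    (PowerSeries A)ˣ :=
  (PowerSeries.isUnit_iff_constantCoeff.mpr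
    ((constantCoeff_charpolyRev M).symm ▸ isUnit_one)).unit

theorem mapUnits_charpolyRevUnit {ι : Type*} [Fintype ι] [DecidableEq ι] (α : A →+* B)
    (M : Matrix ι ι A) : mapUnits α (charpolyRevUnit M) = charpolyRevUnit (M.map α) := by
  ext1
  simp only [charpolyRevUnit, Units.coe_map, IsUnit.unit_spec, charpolyRev_map]
  exact (Polynomial.polynomial_map_coe).symm

theorem logD_charpolyRevUnit {ι : Type*} [Fintype ι] [DecidableEq ι] (M : Matrix ι ι A) :
    logD (charpolyRevUnit M) = -posSeries fun k => (M ^ k).trace :=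
  logD_charpolyRev M _ rfl

theorem detFactor_eq [Nontrivial A] {p m d q : ℕ} (hq : 0 < q) (F : MvPolynomial (Fin n) A)
    (h : ∀ g ∈ RMod A n p m d, psiMul q ((q - 1) * p ^ (m - 1)) F g ∈ RMod A n p m d) (i : ℕ) :
    detFactor F h i = charpolyRevUnit
      ((q : A) ^ i • opMat q (d * p ^ (m - 1)) (F ^ ((q - 1) * p ^ (m - 1)))) := by
  ext1
  rw [detFactor, detUnit, charpolyRevUnit, IsUnit.unit_spec, IsUnit.unit_spec,
    ← toMatrix_restrict hq F h, ← LinearEquiv.map_smul,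
    detOneSub_eq_charpolyRev (monomialBasis A n (d * p ^ (m - 1)))]

end OperatorMatrix

/-! ### Powers of the operator and sums over roots of unity -/

section TraceFormula

variable {A : Type*} [CommRing A] {n : ℕ}

/-- The projection formula for ψ_q. On monomials, adding q • u to an exponent does not affect
divisibility by q. -/
theorem psi_expand_mul {q : ℕ} (hq : 0 < q) (H G : MvPolynomial (Fin n) A) :
    psi A n q (expand q H * G) = H * psi A n q G := by
  classical
  induction H using MvPolynomial.induction_on' with
  | add g₁ g₂ h₁ h₂ => simp [add_mul, h₁, h₂]
  | monomial u a =>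
    induction G using MvPolynomial.induction_on' with
    | add g₁ g₂ h₁ h₂ => rw [mul_add, map_add, h₁, h₂, map_add, mul_add]
    | monomial v b =>
      rw [expand_monomial, monomial_mul, psi_monomial, psi_monomial]
      have : (∀ j, q ∣ (q • u + v) j) ↔ ∀ j, q ∣ v j := by
        refine forall_congr' fun j => ?_
        rw [Finsupp.add_apply, Finsupp.smul_apply, smul_eq_mul]
        exact (Nat.dvd_add_right (dvd_mul_right _ _))
      simp only [this]
      split_ifs with h
      · rw [monomial_mul]
        have hexp : (q • u + v).mapRange (· / q) (Nat.zero_div q) =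
            u + v.mapRange (· / q) (Nat.zero_div q) := by
          ext j
          simp [Nat.mul_add_div hq]
        rw [hexp]
      · simp

theorem opMat_apply (q N : ℕ) (H : MvPolynomial (Fin n) A) (v u : Exps n N) :
    opMat q N H v u = (H * monomial (u : Fin n →₀ ℕ) 1).coeff (q • (v : Fin n →₀ ℕ)) :=
  rfl

/-- The projection formula gives ψ_q H ψ_Q G = ψ_{qQ} H(x^Q) G. The degree bound makes truncation
harmless: G x^u has degree at most (Q - 1)N + N = QN, so ψ_Q brings it back to degree at most N. -/
theorem opMat_mul {q Q N : ℕ} (hQ : 0 < Q) (H G : MvPolynomial (Fin n) A)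
    (hG : G.totalDegree ≤ (Q - 1) * N) :
    opMat q N H * opMat Q N G = opMat (q * Q) N (expand Q H * G) := by
  ext v u
  have hg : psi A n Q (G * monomial (u : Fin n →₀ ℕ) 1) =
      ∑ w : Exps n N, monomial (w : Fin n →₀ ℕ)
        ((G * monomial (u : Fin n →₀ ℕ) 1).coeff (Q • (w : Fin n →₀ ℕ))) := by
    ext w
    rw [coeff_psi hQ, coeff_sum]
    simp only [coeff_monomial]
    by_cases hw : w ∈ {s : Fin n →₀ ℕ | (s.sum fun _ e => e) ≤ N}
    · rw [Finset.sum_eq_single ⟨w, hw⟩]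
      · simp
      · rintro ⟨b, _⟩ _ hb
        rw [if_neg]
        rintro rfl
        exact hb rfl
      · simp
    · rw [Finset.sum_eq_zero]
      · by_contra hne
        apply hw
        have h1 := le_totalDegree (mem_support_iff.mpr hne)
        have h2 := totalDegree_mul G (monomial (u : Fin n →₀ ℕ) (1 : A))
        have h3 := totalDegree_monomial_le (u : Fin n →₀ ℕ) (1 : A)
        have h4 : ((u : Fin n →₀ ℕ).sum fun _ e => e) ≤ N := u.2
        rw [Finsupp.sum_smul_index' (fun _ => rfl)] at h1
        simp only [smul_eq_mul] at h1
        rw [← Finsupp.mul_sum] at h1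
        obtain ⟨Q, rfl⟩ := Nat.exists_eq_succ_of_ne_zero hQ.ne'
        have h5 : Q.succ * (w.sum fun _ e => e) ≤ Q.succ * N := by
          simp only [Nat.succ_eq_add_one, Nat.add_sub_cancel] at hG
          calc _ ≤ Q * N + N := by
                refine h1.trans (h2.trans (add_le_add hG (h3.trans h4)))
            _ = _ := by rw [Nat.succ_mul]
        exact Nat.le_of_mul_le_mul_left h5 (Nat.succ_pos _)
      · rintro ⟨b, hb⟩ _
        rw [if_neg]
        rintro rfl
        exact hw hb
  rw [opMat_apply, mul_assoc, mul_comm q, mul_smul, ← coeff_psi hQ, psi_expand_mul hQ, hg,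
    Finset.mul_sum, coeff_sum, Matrix.mul_apply]
  refine Finset.sum_congr rfl fun w _ => ?_
  rw [opMat_apply, opMat_apply, mul_comm,
    ← coeff_C_mul, mul_left_comm, C_mul_monomial, mul_one]

/-- The product `H(x) H(x ^ q) ⋯ H(x ^ (q ^ (k - 1)))`. -/
def frobProd (q : ℕ) (H : MvPolynomial (Fin n) A) (k : ℕ) : MvPolynomial (Fin n) A :=
  ∏ j ∈ Finset.range k, expand (q ^ j) H

theorem totalDegree_frobProd {q N : ℕ} (hq : 0 < q) {H : MvPolynomial (Fin n) A}
    (hH : H.totalDegree ≤ (q - 1) * N) (k : ℕ) :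
    (frobProd q H k).totalDegree ≤ (q ^ k - 1) * N := by
  induction k with
  | zero => simp [frobProd]
  | succ k ih =>
    rw [frobProd, Finset.prod_range_succ]
    refine (totalDegree_mul _ _).trans ?_
    rw [totalDegree_expand]
    refine (add_le_add ih (Nat.mul_le_mul_right _ hH)).trans (le_of_eq ?_)
    obtain ⟨q, rfl⟩ := Nat.exists_eq_succ_of_ne_zero hq.ne'
    obtain ⟨r, hr⟩ := Nat.exists_eq_succ_of_ne_zero (pow_pos hq k).ne'
    rw [pow_succ, hr]
    simp only [Nat.succ_eq_add_one, Nat.add_sub_cancel]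
    rw [show (r + 1) * (q + 1) - 1 = r * q + r + q by ring_nf; omega]
    ring

theorem opMat_pow {q N : ℕ} (hq : 0 < q) {H : MvPolynomial (Fin n) A}
    (hH : H.totalDegree ≤ (q - 1) * N) (k : ℕ) :
    opMat q N H ^ k = opMat (q ^ k) N (frobProd q H k) := by
  induction k with
  | zero =>
    ext v u
    simp [opMat, frobProd, Matrix.one_apply, coeff_monomial, Subtype.ext_iff, eq_comm]
  | succ k ih =>
    rw [pow_succ', ih, opMat_mul (pow_pos hq k) _ _ (totalDegree_frobProd hq hH k), frobProd, frobProd,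
      Finset.prod_range_succ, mul_comm (∏ j ∈ _, _), ← pow_succ']

theorem trace_opMat {q N : ℕ} (hq : 0 < q) (H : MvPolynomial (Fin n) A) :
    (opMat q N H).trace = ∑ u : Exps n N, H.coeff ((q - 1) • (u : Fin n →₀ ℕ)) := by
  refine Finset.sum_congr rfl fun u _ => ?_
  rw [Matrix.diag_apply, opMat_apply]
  obtain ⟨q, rfl⟩ := Nat.exists_eq_succ_of_ne_zero hq.ne'
  rw [Nat.succ_eq_add_one, Nat.add_sub_cancel, succ_nsmul, coeff_mul_monomial, mul_one]

variable [IsDomain A]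

instance fintypeRootsOfUnity (M : ℕ) [NeZero M] : Fintype (rootsOfUnity M A) := Fintype.ofFinite _

/-- Orthogonality of characters: ζ ↦ ζ^v is trivial exactly when M ∣ v, because the group is cyclic
of order M. -/
theorem sum_rootsOfUnity_pow {M : ℕ} [NeZero M] (hM : Nat.card (rootsOfUnity M A) = M) (v : ℕ) :
    ∑ ζ : rootsOfUnity M A, ((ζ : Aˣ) : A) ^ v = if M ∣ v then (M : A) else 0 := by
  classical
  let f : rootsOfUnity M A →* A :=
    (powMonoidHom v).comp ((Units.coeHom A).comp (rootsOfUnity M A).subtype)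
  have hf : ∀ ζ : rootsOfUnity M A, f ζ = ((ζ : Aˣ) : A) ^ v := fun _ => rfl
  have hiff : f = 1 ↔ M ∣ v := by
    constructor
    · intro h
      obtain ⟨ζ, hζ⟩ := IsCyclic.exists_generator (α := rootsOfUnity M A)
      have ho : orderOf ζ = M := (orderOf_eq_card_of_forall_mem_zpowers hζ).trans hM
      rw [← ho, orderOf_dvd_iff_pow_eq_one]
      have := DFunLike.congr_fun h ζ
      rw [hf, MonoidHom.one_apply] at this
      ext
      simpa using this
    · rintro ⟨c, rfl⟩
      ext ζ
      rw [hf, pow_mul, MonoidHom.one_apply, ← Units.val_pow_eq_pow_val,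
        (mem_rootsOfUnity _ _).mp ζ.2, Units.val_one, one_pow]
  have h := sum_hom_units f
  rw [Fintype.card_eq_nat_card, hM] at h
  simp only [hiff, hf] at h
  rw [h]
  split_ifs <;> simp

/-- Orthogonality in each variable keeps only the monomials with exponent M • u, each with factor
M^n. The degree bound forces u to have degree at most N. -/
theorem sum_eval_rootsOfUnity {M N : ℕ} [NeZero M] (hM : Nat.card (rootsOfUnity M A) = M)
    {H : MvPolynomial (Fin n) A} (hH : H.totalDegree ≤ M * N) :
    ∑ x : Fin n → rootsOfUnity M A, eval (fun i => ((x i : Aˣ) : A)) H =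
      (M : A) ^ n * ∑ u : Exps n N, H.coeff (M • (u : Fin n →₀ ℕ)) := by
  classical
  simp only [eval_eq']
  rw [Finset.sum_comm]
  have h1 : ∀ s : Fin n →₀ ℕ, ∑ x : Fin n → rootsOfUnity M A,
      H.coeff s * ∏ i, ((x i : Aˣ) : A) ^ s i = if ∀ i, M ∣ s i then (M : A) ^ n * H.coeff s else 0 := by
    intro s
    rw [← Finset.mul_sum, ← Fintype.prod_sum fun i (ζ : rootsOfUnity M A) => ((ζ : Aˣ) : A) ^ s i]
    simp only [sum_rootsOfUnity_pow hM]
    split_ifs with h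
    · rw [Finset.prod_congr rfl fun i _ => if_pos (h i)]
      simp [mul_comm]
    · push Not at h
      obtain ⟨i, hi⟩ := h
      rw [Finset.prod_eq_zero (Finset.mem_univ i) (if_neg hi), mul_zero]
  rw [Finset.sum_congr rfl fun s _ => h1 s, ← Finset.sum_filter, ← Finset.mul_sum]
  congr 1
  symm
  have hM0 : M ≠ 0 := NeZero.ne M
  have hmem : ∀ s ∈ H.support, (∀ i, M ∣ s i) → ∃ u : Exps n N, M • (u : Fin n →₀ ℕ) = s := by
    intro s hs hd
    refine ⟨⟨s.mapRange (· / M) (Nat.zero_div M), ?_⟩, ?_⟩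
    · have h2 := (le_totalDegree hs).trans hH
      have h3 : M • s.mapRange (· / M) (Nat.zero_div M) = s := by
        ext i
        simp [Nat.mul_div_cancel' (hd i)]
      rw [← h3, Finsupp.sum_smul_index' (fun _ => rfl)] at h2
      simp only [smul_eq_mul] at h2
      rw [← Finsupp.mul_sum] at h2
      exact Nat.le_of_mul_le_mul_left h2 (Nat.pos_of_ne_zero hM0)
    · ext i
      simp [Nat.mul_div_cancel' (hd i)]
  have hinj : Set.InjOn (fun u : Exps n N => M • (u : Fin n →₀ ℕ)) (Finset.univ : Finset (Exps n N)) := by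
    intro u _ v _ huv
    ext i
    have := DFunLike.congr_fun huv i
    simpa [hM0] using this
  refine ((Finset.sum_image (f := fun s => H.coeff s) hinj).symm).trans (Eq.symm ?_)
  refine Finset.sum_subset ?_ ?_
  · intro s hs
    rw [Finset.mem_filter] at hs
    obtain ⟨u, hu⟩ := hmem s hs.1 hs.2
    exact Finset.mem_image.mpr ⟨u, Finset.mem_univ _, hu⟩
  · intro s hs hs'
    obtain ⟨u, -, rfl⟩ := Finset.mem_image.mp hs
    by_contra hne
    exact hs' (Finset.mem_filter.mpr ⟨mem_support_iff.mpr hne, fun i => by simp⟩)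

end TraceFormula

/-! ### The q-power map on the torus and Dwork's trace formula -/

section PowerMap

variable {A : Type*} [CommRing A] {n : ℕ}

/-- The `q`-power map on the torus. -/
def powMap (A : Type*) [CommRing A] (n q : ℕ) (x : Fin n → Aˣ) : Fin n → Aˣ := x ^ q

theorem powMap_iterate (q k : ℕ) (x : Fin n → Aˣ) : (powMap A n q)^[k] x = x ^ q ^ k := by
  induction k with
  | zero => simp
  | succ k ih => rw [Function.iterate_succ_apply', ih, powMap, ← pow_mul, pow_succ]

theorem pow_eq_self_iff {G : Type*} [Group G] {q : ℕ} (hq : 0 < q) (x : G) :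
    x ^ q = x ↔ x ^ (q - 1) = 1 := by
  obtain ⟨q, rfl⟩ := Nat.exists_eq_succ_of_ne_zero hq.ne'
  simp [pow_succ]

theorem ptsOfPeriod_powMap {q : ℕ} (hq : 0 < q) (k : ℕ) :
    Function.ptsOfPeriod (powMap A n q) k =
      Set.range fun (y : Fin n → rootsOfUnity (q ^ k - 1) A) i => (y i : Aˣ) := by
  ext x
  rw [Function.mem_ptsOfPeriod, Function.IsPeriodicPt, Function.IsFixedPt, powMap_iterate,
    pow_eq_self_iff (pow_pos hq k)]
  constructor
  · intro h
    exact ⟨fun i => ⟨x i, congrFun h i⟩, rfl⟩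
  · rintro ⟨y, rfl⟩
    ext1 i
    exact (y i).2

variable [IsDomain A]

theorem finite_ptsOfPeriod_powMap {q : ℕ} (hq : 1 < q) {k : ℕ} (hk : 0 < k) :
    (Function.ptsOfPeriod (powMap A n q) k).Finite := by
  have : NeZero (q ^ k - 1) := ⟨(Nat.sub_pos_of_lt (Nat.one_lt_pow hk.ne' hq)).ne'⟩
  rw [ptsOfPeriod_powMap (by omega)]
  exact Set.finite_range _

/-- Dwork's trace formula. -/
theorem orbitSum_powMap {q N : ℕ} (hq : 1 < q) {H : MvPolynomial (Fin n) A}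
    (hH : H.totalDegree ≤ (q - 1) * N) {k : ℕ} (hk : 0 < k)
    (hcard : Nat.card (rootsOfUnity (q ^ k - 1) A) = q ^ k - 1) :
    orbitSum (powMap A n q) (fun x => eval (fun i => (x i : A)) H) k =
      ((q : A) ^ k - 1) ^ n * (opMat q N H ^ k).trace := by
  have hq0 : 0 < q := by omega
  have : NeZero (q ^ k - 1) := ⟨(Nat.sub_pos_of_lt (Nat.one_lt_pow hk.ne' hq)).ne'⟩
  have hinj : Function.Injective
      fun (y : Fin n → rootsOfUnity (q ^ k - 1) A) i => (y i : Aˣ) := by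
    intro y z h
    ext1 i
    exact Subtype.ext (congrFun h i)
  rw [orbitSum, ptsOfPeriod_powMap hq0, finsum_mem_range hinj, finsum_eq_sum_of_fintype,
    opMat_pow hq0 hH, trace_opMat (pow_pos hq0 k)]
  have hcast : ((q ^ k - 1 : ℕ) : A) = (q : A) ^ k - 1 := by
    rw [Nat.cast_sub (Nat.one_le_pow _ _ hq0)]; simp
  rw [← hcast, ← sum_eval_rootsOfUnity hcard (totalDegree_frobProd hq0 hH k)]
  refine Finset.sum_congr rfl fun x _ => ?_
  rw [trajProd, frobProd, map_prod]
  refine Finset.prod_congr rfl fun j _ => ?_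
  rw [powMap_iterate, eval_expand]
  rfl

end PowerMap
end WanZeta

namespace WanZeta
open MvPolynomial

/-! ### A valuation ring with all roots of unity -/

section LocalExtension

/-- A domain of characteristic zero in which `p` is not invertible maps to a local domain of
characteristic zero in which `p` is not invertible and which contains all roots of unity. -/
theorem exists_local_extension {A : Type*} [CommRing A] [IsDomain A] [CharZero A] {p : ℕ}
    (hp : ¬IsUnit (p : A)) :
    ∃ V : ValuationSubring (AlgebraicClosure (FractionRing A)), ∃ _ : A →+* V,
      CharZero V ∧ (p : V) ∈ IsLocalRing.maximalIdeal V ∧ ∀ M > 0, ∃ ζ : V, IsPrimitiveRoot ζ M := by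
  let j₀ : A →+* AlgebraicClosure (FractionRing A) :=
    (algebraMap (FractionRing A) _).comp (algebraMap A _)
  have hj₀ : Function.Injective j₀ :=
    (algebraMap (FractionRing A) _).injective.comp (IsFractionRing.injective A _)
  have : CharZero (AlgebraicClosure (FractionRing A)) := charZero_of_injective_ringHom hj₀
  -- A proper ideal of a subring of a field lies in the nonunits of some valuation ring containing
  -- the subring.
  have hne : (Ideal.span {(p : j₀.range)} : Ideal j₀.range) ≠ ⊤ := by
    rw [Ne, Ideal.span_singleton_eq_top, isUnit_iff_exists_inv]
    rintro ⟨⟨_, b, rfl⟩, hb⟩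
    apply hp
    rw [isUnit_iff_exists_inv]
    refine ⟨b, hj₀ ?_⟩
    have := congrArg Subtype.val hb
    simpa using this
  obtain ⟨V, hV, hVp⟩ := Ideal.image_subset_nonunits_valuationSubring _ hne
  refine ⟨V, (Subring.inclusion hV).comp j₀.rangeRestrict, RingHom.charZero V.subtype, ?_, fun M hM => ?_⟩
  · rw [← ValuationSubring.coe_mem_nonunits_iff]
    exact hVp ⟨(p : j₀.range), Ideal.subset_span rfl, by simp⟩
  · have : NeZero M := ⟨hM.ne'⟩
    obtain ⟨ζ, hζ⟩ := HasEnoughRootsOfUnity.exists_primitiveRoot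
      (AlgebraicClosure (FractionRing A)) M
    -- The valuation ring contains ζ or ζ⁻¹, and each is a power of the other.
    have hmem : ζ ∈ V := by
      rcases V.mem_or_inv_mem ζ with h | h
      · exact h
      · have : ζ = ζ⁻¹ ^ (M - 1) := by
          have h0 : ζ ≠ 0 := hζ.ne_zero hM.ne'
          have h1 := hζ.pow_eq_one
          rw [← Nat.sub_add_cancel hM, pow_succ] at h1
          rw [inv_pow]
          exact eq_inv_of_mul_eq_one_right h1
        rw [this]
        exact pow_mem h _
    exact ⟨⟨ζ, hmem⟩, IsPrimitiveRoot.of_map_of_injective (f := V.subtype) hζ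
      Subtype.val_injective⟩

end LocalExtension

/-! ### Teichmüller points and point counts -/

section Residue

open IsLocalRing

variable {V : Type*} [CommRing V] [IsLocalRing V]

variable {p : ℕ} [Fact p.Prime] {Fq : Type*} [Field Fq] [Finite Fq] [CharP Fq p]

theorem residue_natCast_card_pow_sub_one_ne_zero (g : Fq →+* ResidueField V) {k : ℕ} (hk : 0 < k) :
    residue V ((Nat.card Fq ^ k - 1 : ℕ) : V) ≠ 0 := by
  have h0 : ((Nat.card Fq : ℕ) : Fq) = 0 := by
    have := Fintype.ofFinite Fq
    rw [Nat.card_eq_fintype_card]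
    exact Nat.cast_card_eq_zero Fq
  have hz : ((Nat.card Fq : ℕ) : ResidueField V) = 0 := by
    rw [← map_natCast g, h0, map_zero]
  rw [map_natCast, Nat.cast_sub (Nat.one_le_pow _ _ Nat.card_pos), Nat.cast_pow, hz,
    zero_pow hk.ne']
  simp

variable {n : ℕ}

/-- The value at the reduction of a point of the torus. -/
def resEval (f : MvPolynomial (Fin n) (ResidueField V)) (x : Fin n → Vˣ) : ResidueField V :=
  eval (fun i => residue V (x i)) f

/-- The indicator function of a hypersurface in the torus. -/
def zeroIndicator (f : MvPolynomial (Fin n) (ResidueField V)) (x : Fin n → Vˣ) : ℤ :=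
  open Classical in if resEval f x = 0 then 1 else 0

theorem expand_card_eq_pow (f : MvPolynomial (Fin n) Fq) :
    expand (Nat.card Fq) f = f ^ Nat.card Fq := by
  have := Fintype.ofFinite Fq
  obtain ⟨p, _⟩ := CharP.exists Fq
  obtain ⟨r, hp, hr⟩ := FiniteField.card Fq p
  have : Fact p.Prime := ⟨hp⟩
  rw [Nat.card_eq_fintype_card, hr, ← map_iterateFrobenius_expand p f r]
  have : iterateFrobenius Fq p r = RingHom.id Fq := by
    ext a
    rw [iterateFrobenius_def, ← hr, FiniteField.pow_card, RingHom.id_apply]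
  rw [this, map_id]

theorem resEval_pow (g : Fq →+* ResidueField V) (f : MvPolynomial (Fin n) Fq) (x : Fin n → Vˣ)
    (j : ℕ) : resEval (map g f) (x ^ Nat.card Fq ^ j) = resEval (map g f) x ^ Nat.card Fq ^ j := by
  induction j with
  | zero => simp
  | succ j ih =>
    rw [pow_succ, pow_mul, pow_mul, ← ih]
    generalize x ^ Nat.card Fq ^ j = y
    rw [resEval, resEval, ← map_pow, ← map_pow, ← expand_card_eq_pow, map_expand,
      eval_expand]
    congr 1

/-- Since f has coefficients in `Fq`, its reduced value at x^(q^j) is the q^j-th power of its value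
at x, so vanishing is constant along trajectories. -/
theorem zeroIndicator_powMap_iterate (g : Fq →+* ResidueField V) (f : MvPolynomial (Fin n) Fq)
    (x : Fin n → Vˣ) (j : ℕ) :
    zeroIndicator (map g f) ((powMap V n (Nat.card Fq))^[j] x) = zeroIndicator (map g f) x := by
  have : Nat.card Fq ^ j ≠ 0 := pow_ne_zero _ Nat.card_pos.ne'
  have hiff : resEval (map g f) ((powMap V n (Nat.card Fq))^[j] x) = 0 ↔
      resEval (map g f) x = 0 := by
    rw [powMap_iterate, resEval_pow, pow_eq_zero_iff this]
  by_cases h0 : resEval (map g f) x = 0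
  · rw [zeroIndicator, zeroIndicator, if_pos h0, if_pos (hiff.mpr h0)]
  · rw [zeroIndicator, zeroIndicator, if_neg h0, if_neg (mt hiff.mp h0)]

/-- The indicator function of the complement of a hypersurface in the torus. -/
def unitIndicator (f : MvPolynomial (Fin n) (ResidueField V)) (x : Fin n → Vˣ) : ℤ :=
  1 - zeroIndicator f x

theorem unitIndicator_eq (f : MvPolynomial (Fin n) (ResidueField V)) (x : Fin n → Vˣ)
    [Decidable (resEval f x = 0)] : unitIndicator f x = if resEval f x = 0 then 0 else 1 := by
  rw [unitIndicator, zeroIndicator]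
  split_ifs <;> rfl

theorem trajProd_zeroIndicator (g : Fq →+* ResidueField V) (f : MvPolynomial (Fin n) Fq)
    (x : Fin n → Vˣ) {k : ℕ} (hk : 0 < k) :
    trajProd (powMap V n (Nat.card Fq)) (zeroIndicator (map g f)) k x =
      zeroIndicator (map g f) x := by
  simp only [trajProd, zeroIndicator_powMap_iterate]
  rw [Finset.prod_const, Finset.card_range, zeroIndicator]
  split_ifs
  · rw [one_pow]
  · rw [zero_pow hk.ne']

theorem trajProd_unitIndicator (g : Fq →+* ResidueField V) (f : MvPolynomial (Fin n) Fq)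
    (x : Fin n → Vˣ) {k : ℕ} (hk : 0 < k) :
    trajProd (powMap V n (Nat.card Fq)) (unitIndicator (map g f)) k x =
      unitIndicator (map g f) x := by
  classical
  simp only [trajProd, unitIndicator, zeroIndicator_powMap_iterate]
  rw [Finset.prod_const, Finset.card_range, ← unitIndicator, unitIndicator_eq]
  split_ifs
  · rw [zero_pow hk.ne']
  · rw [one_pow]

theorem hypersurfaceCount_zero (n : ℕ) (k : ℕ+) :
    hypersurfaceCount p (0 : MvPolynomial (Fin n) Fq) k = torusCount p Fq n k :=
  Nat.card_congr ((Equiv.subtypeUnivEquiv fun _ => map_zero _))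

variable [IsDomain V]

/-- The product of the 1 - ζ^l over 0 < l < M is M. If the order dropped under reduction, one factor
would reduce to 0, contrary to `hMV`. -/
theorem isPrimitiveRoot_residue {M : ℕ} (hM : 0 < M) (hMV : residue V (M : V) ≠ 0) {ζ : V}
    (hζ : IsPrimitiveRoot ζ M) : IsPrimitiveRoot (residue V ζ) M := by
  rw [IsPrimitiveRoot.iff hM, ← map_pow, hζ.pow_eq_one, map_one]
  refine ⟨rfl, fun l hl0 hlM hl => hMV ?_⟩
  obtain ⟨M, rfl⟩ := Nat.exists_eq_succ_of_ne_zero hM.ne'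
  obtain ⟨l, rfl⟩ := Nat.exists_eq_succ_of_ne_zero hl0.ne'
  have h := congrArg (residue V) hζ.prod_one_sub_pow_eq_order
  rw [map_prod, Finset.prod_eq_zero (Finset.mem_range.mpr (Nat.lt_of_succ_lt_succ hlM))] at h
  · simpa using h.symm
  · rw [map_sub, map_pow, map_one, sub_eq_zero]
    exact hl.symm

/-- Reduction identifies the roots of unity of order `q ^ k - 1` with the invertible elements of the
field with `q ^ k` elements. -/
theorem exists_rootsOfUnity_equiv (g : Fq →+* ResidueField V)
    (hroots : ∀ M > 0, ∃ ζ : V, IsPrimitiveRoot ζ M) (k : ℕ+) :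
    ∃ (i : FiniteField.Extension Fq p k →+* ResidueField V)
      (E : rootsOfUnity (Nat.card Fq ^ (k : ℕ) - 1) V ≃ (FiniteField.Extension Fq p k)ˣ),
      i.comp (algebraMap Fq _) = g ∧ ∀ ζ, i (E ζ) = residue V ((ζ : Vˣ) : V) := by
  set M := Nat.card Fq ^ (k : ℕ) - 1 with hM
  have hM0 : 0 < M := Nat.sub_pos_of_lt (Nat.one_lt_pow k.ne_zero Finite.one_lt_card)
  have : NeZero M := ⟨hM0.ne'⟩
  obtain ⟨ζ, hζ⟩ := hroots M hM0
  have hζ' : IsPrimitiveRoot (residue V ζ) M :=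
    isPrimitiveRoot_residue hM0 (residue_natCast_card_pow_sub_one_ne_zero g k.pos) hζ
  let : Algebra Fq (ResidueField V) := g.toAlgebra
  -- The extension of degree k is a splitting field of this polynomial, and the reduced primitive
  -- root splits it, which yields the embedding `i`.
  have hsplit : ((Polynomial.X ^ Nat.card Fq ^ (k : ℕ) - Polynomial.X : Polynomial Fq).map
      (algebraMap Fq (ResidueField V))).Splits := by
    have h1 : (Polynomial.X ^ Nat.card Fq ^ (k : ℕ) - Polynomial.X : Polynomial Fq).map
        (algebraMap Fq (ResidueField V)) =
          Polynomial.X * (Polynomial.X ^ M - Polynomial.C 1) := by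
      have h2 : Nat.card Fq ^ (k : ℕ) = M + 1 :=
        (Nat.sub_add_cancel (Nat.one_le_pow _ _ Nat.card_pos)).symm
      rw [h2, Polynomial.map_sub, Polynomial.map_pow, Polynomial.map_X, map_one]
      ring
    rw [h1]
    exact Polynomial.Splits.X.mul (Polynomial.X_pow_sub_one_splits hζ')
  let i : FiniteField.Extension Fq p k →ₐ[Fq] ResidueField V :=
    Polynomial.IsSplittingField.lift _ (Polynomial.X ^ Nat.card Fq ^ (k : ℕ) - Polynomial.X) hsplit
  have hcardV : Nat.card (rootsOfUnity M V) = M := hζ.card_rootsOfUnity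
  have hcardk : Nat.card (rootsOfUnity M (ResidueField V)) = M := hζ'.card_rootsOfUnity
  have hcardE : Nat.card (FiniteField.Extension Fq p k)ˣ = M := by
    rw [Nat.card_units, FiniteField.natCard_extension]
  -- Both groups inject into the M-th roots of unity of the residue field, and all three have M
  -- elements; `E` is `a` followed by the inverse of `b`.
  let a : rootsOfUnity M V →* rootsOfUnity M (ResidueField V) :=
    restrictRootsOfUnity (residue V) M
  have ha : Function.Bijective a := by
    refine Function.Injective.bijective_of_nat_card_le ?_ (by rw [hcardV, hcardk])
    rw [injective_iff_map_eq_one]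
    intro z hz
    obtain ⟨l, -, hl⟩ := hζ.eq_pow_of_pow_eq_one
      (show ((z : Vˣ) : V) ^ M = 1 by
        rw [← Units.val_pow_eq_pow_val, (mem_rootsOfUnity _ _).mp z.2, Units.val_one])
    have h1 : residue V ((z : Vˣ) : V) = 1 :=
      congrArg (fun y : rootsOfUnity M (ResidueField V) => ((y : (ResidueField V)ˣ) : ResidueField V)) hz
    rw [← hl, map_pow, hζ'.pow_eq_one_iff_dvd, ← hζ.pow_eq_one_iff_dvd, hl] at h1
    exact Subtype.ext (Units.ext h1)
  let b : (FiniteField.Extension Fq p k)ˣ → rootsOfUnity M (ResidueField V) := fun y =>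
    ⟨Units.map (i : _ →* ResidueField V) y, by
      rw [mem_rootsOfUnity, ← map_pow, ← hcardE, pow_card_eq_one', map_one]⟩
  have hb : Function.Bijective b := by
    refine Function.Injective.bijective_of_nat_card_le ?_ (by rw [hcardE, hcardk])
    intro y z hyz
    exact Units.map_injective (f := (i : _ →* ResidueField V)) i.toRingHom.injective
      (congrArg Subtype.val hyz)
  refine ⟨i, (Equiv.ofBijective a ha).trans (Equiv.ofBijective b hb).symm, ?_, fun z => ?_⟩
  · exact i.comp_algebraMap
  · have h1 : b ((Equiv.ofBijective b hb).symm (a z)) = a z :=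
      (Equiv.ofBijective b hb).apply_symm_apply (a z)
    exact congrArg (fun y : rootsOfUnity M (ResidueField V) =>
      ((y : (ResidueField V)ˣ) : ResidueField V)) h1

theorem hypersurfaceCount_eq (g : Fq →+* ResidueField V)
    (hroots : ∀ M > 0, ∃ ζ : V, IsPrimitiveRoot ζ M) (f : MvPolynomial (Fin n) Fq) (k : ℕ+) :
    hypersurfaceCount p f k =
      Nat.card {x : Fin n → rootsOfUnity (Nat.card Fq ^ (k : ℕ) - 1) V //
        resEval (map g f) (fun i => x i) = 0} := by
  obtain ⟨i, E, hi, hE⟩ := exists_rootsOfUnity_equiv (p := p) g hroots k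
  symm
  refine Nat.card_congr (Equiv.subtypeEquiv (Equiv.piCongrRight fun _ => E) fun x => ?_)
  rw [← map_eq_zero_iff i i.injective, aeval_def, ← coe_eval₂Hom, ← RingHom.comp_apply]
  have : resEval (map g f) (fun i => x i) = i.comp (eval₂Hom (algebraMap Fq _)
      fun j => (((Equiv.piCongrRight fun _ => E) x j : (FiniteField.Extension Fq p k)ˣ) :
        FiniteField.Extension Fq p k)) f := by
    rw [resEval, eval_map, comp_eval₂Hom, hi, coe_eval₂Hom]
    congr 1
    ext1 j
    exact (hE (x j)).symm
  rw [this]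

theorem orbitSum_zeroIndicator (g : Fq →+* ResidueField V)
    (hroots : ∀ M > 0, ∃ ζ : V, IsPrimitiveRoot ζ M) (f : MvPolynomial (Fin n) Fq) (k : ℕ+) :
    orbitSum (powMap V n (Nat.card Fq)) (zeroIndicator (map g f)) k = hypersurfaceCount p f k := by
  classical
  have : NeZero (Nat.card Fq ^ (k : ℕ) - 1) :=
    ⟨(Nat.sub_pos_of_lt (Nat.one_lt_pow k.ne_zero Finite.one_lt_card)).ne'⟩
  have hinj : Function.Injective
      fun (y : Fin n → rootsOfUnity (Nat.card Fq ^ (k : ℕ) - 1) V) i => (y i : Vˣ) := by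
    intro y z h
    ext1 i
    exact Subtype.ext (congrFun h i)
  rw [hypersurfaceCount_eq g hroots, orbitSum, ptsOfPeriod_powMap Nat.card_pos,
    finsum_mem_range hinj, finsum_eq_sum_of_fintype,
    Nat.card_eq_fintype_card (α := {x : Fin n → rootsOfUnity _ V // _}), Fintype.card_subtype, Finset.card_filter,
    Nat.cast_sum]
  refine Finset.sum_congr rfl fun x _ => ?_
  rw [trajProd_zeroIndicator g f _ k.pos, zeroIndicator]
  split_ifs <;> simp

/-- The torus is treated as the hypersurface of the zero polynomial, so this is the point count
behind Z_U Z_X = Z_G. -/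
theorem orbitSum_unitIndicator (g : Fq →+* ResidueField V) (f : MvPolynomial (Fin n) Fq) {k : ℕ}
    (hk : 0 < k) :
    orbitSum (powMap V n (Nat.card Fq)) (unitIndicator (map g f)) k +
      orbitSum (powMap V n (Nat.card Fq)) (zeroIndicator (map g f)) k =
      orbitSum (powMap V n (Nat.card Fq)) (zeroIndicator (map g 0)) k := by
  rw [orbitSum, orbitSum, orbitSum, ← finsum_mem_add_distrib
    (finite_ptsOfPeriod_powMap Finite.one_lt_card hk)]
  refine finsum_mem_congr rfl fun x _ => ?_
  rw [trajProd_unitIndicator g f x hk, trajProd_zeroIndicator g f x hk,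
    trajProd_zeroIndicator g 0 x hk, unitIndicator, sub_add_cancel, zeroIndicator, if_pos]
  rw [map_zero, resEval, map_zero]

end Residue
end WanZeta

namespace WanZeta
open MvPolynomial IsLocalRing

/-! ### The logarithmic derivative of the zeta function of point counts -/

section Zeta

open PowerSeries in
-- The chain rule gives exp(h)' = h' exp(h), and T h' is the generating series of the counts. The
-- value of s at 0 is free because `posSeries` ignores it.
theorem logD_zetaOfCounts (N : ℕ+ → ℕ) :
    constantCoeff (zetaOfCounts N) = 1 ∧
      ∀ u : (PowerSeries ℚ)ˣ, (u : PowerSeries ℚ) = zetaOfCounts N →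
        ∀ s : ℕ → ℚ, (∀ k : ℕ+, s k = N k) → logD u = posSeries s := by
  set h : PowerSeries ℚ := PowerSeries.X * PowerSeries.mk fun k : ℕ =>
    (N k.succPNat : ℚ) / (k + 1 : ℚ) with hh
  have h0 : PowerSeries.constantCoeff h = 0 := by simp [hh]
  have hs : PowerSeries.HasSubst h := PowerSeries.HasSubst.of_constantCoeff_zero h0
  constructor
  · have h1 : PowerSeries.exp ℚ = 1 + (PowerSeries.exp ℚ - 1) := by ring
    have h2 : PowerSeries.constantCoeff (PowerSeries.exp ℚ - 1) = 0 := by simp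
    have h3 := PowerSeries.constantCoeff_subst_eq_zero (a := h) h0 _ h2
    rw [zetaOfCounts, ← hh, h1, ← PowerSeries.coe_substAlgHom hs, map_add, map_one, map_add,
      map_one, PowerSeries.coe_substAlgHom]
    rw [show PowerSeries.constantCoeff (PowerSeries.subst h (PowerSeries.exp ℚ - 1)) = 0 from h3,
      add_zero]
  · intro u hu s hsN
    apply logD_eq_of_mul_self
    rw [hu, zetaOfCounts, ← hh, PowerSeries.derivative_subst hs, PowerSeries.derivative_exp,
      mul_left_comm, mul_comm]
    congr 1
    ext k
    rcases k with _ | k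
    · simp [posSeries]
    · rw [coeff_succ_X_mul, coeff_derivative, hh, coeff_succ_X_mul, coeff_mk, posSeries, coeff_mk,
        if_neg (Nat.succ_ne_zero k)]
      have : (k : ℚ) + 1 ≠ 0 := by positivity
      rw [div_mul_cancel₀ _ this]
      exact hsN k.succPNat

end Zeta

/-! ### Lifts of f and their values at Teichmüller points modulo p^m -/

section Lift

variable {A k : Type*} [CommRing A] [CommRing k] {n : ℕ}

theorem exists_map_eq_totalDegree_le {r : A →+* k} (hr : Function.Surjective r)
    (f : MvPolynomial (Fin n) k) :
    ∃ G : MvPolynomial (Fin n) A, map r G = f ∧ G.totalDegree ≤ f.totalDegree := by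
  choose c hc using hr
  refine ⟨∑ s ∈ f.support, monomial s (c (f.coeff s)), ?_, ?_⟩
  · rw [map_sum]
    conv_rhs => rw [f.as_sum]
    refine Finset.sum_congr rfl fun s _ => ?_
    rw [map_monomial, hc]
  · exact totalDegree_finsetSum_le fun s hs =>
      (totalDegree_monomial_le _ _).trans (le_totalDegree hs)

theorem natCast_dvd_of_map_eq_zero {r : A →+* k} {p : ℕ} (hr : ∀ a, r a = 0 → (p : A) ∣ a)
    {G : MvPolynomial (Fin n) A} (hG : map r G = 0) : (p : MvPolynomial (Fin n) A) ∣ G := by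
  rw [← map_natCast (C (σ := Fin n) (R := A)), C_dvd_iff_dvd_coeff]
  intro s
  apply hr
  rw [← coeff_map, hG, coeff_zero]

end Lift

section Congruence

variable {A V Fq : Type*} [CommRing A] [CommRing V] [Field Fq] {n p : ℕ} {r : A →+* Fq}
  {j : A →+* V}

/-- The value of a polynomial at a point of the torus. -/
def torusEval (H : MvPolynomial (Fin n) V) (x : Fin n → Vˣ) : V :=
  eval (fun i => (x i : V)) H

theorem residue_torusEval [IsLocalRing V] {g : Fq →+* ResidueField V}
    (hg : ∀ a, residue V (j a) = g (r a)) (G : MvPolynomial (Fin n) A)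
    (x : Fin n → Vˣ) : residue V (torusEval (map j G) x) = resEval (map g (map r G)) x := by
  have h : (residue V).comp j = g.comp r := RingHom.ext hg
  rw [torusEval, resEval, map_map, ← h, ← map_map, eval_map (residue V), ← coe_eval₂Hom, eval,
    ← RingHom.comp_apply, comp_eval₂Hom]
  rfl

variable [Finite Fq]

/-- Over `Fq` one has f(x)^q = f(x^q), so the two sides already agree modulo p as polynomials over
`A`. -/
theorem dvd_torusEval_pow_sub (hr : ∀ a, r a = 0 → (p : A) ∣ a) (G : MvPolynomial (Fin n) A)
    (x : Fin n → Vˣ) :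
    (p : V) ∣ torusEval (map j G) x ^ Nat.card Fq - torusEval (map j G) (x ^ Nat.card Fq) := by
  have h : (p : MvPolynomial (Fin n) A) ∣ G ^ Nat.card Fq - expand (Nat.card Fq) G := by
    apply natCast_dvd_of_map_eq_zero hr
    rw [map_sub, map_pow, map_expand, expand_card_eq_pow, sub_self]
  have h2 := map_dvd ((eval fun i => (x i : V)).comp (map j)) h
  rw [map_natCast, map_sub, map_pow, RingHom.comp_apply, RingHom.comp_apply, map_expand,
    eval_expand] at h2
  exact h2

theorem dvd_torusEval_pow_pow_sub (hr : ∀ a, r a = 0 → (p : A) ∣ a) (G : MvPolynomial (Fin n) A)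
    (x : Fin n → Vˣ) (i : ℕ) :
    (p : V) ∣ torusEval (map j G) x ^ Nat.card Fq ^ i -
      torusEval (map j G) (x ^ Nat.card Fq ^ i) := by
  induction i with
  | zero => simp
  | succ i ih =>
    have h1 := ih.trans (sub_dvd_pow_sub_pow _ _ (Nat.card Fq))
    have h2 := dvd_torusEval_pow_sub (j := j) hr G (x ^ Nat.card Fq ^ i)
    rw [← pow_mul, ← pow_succ] at h1 h2
    simpa using dvd_add h1 h2

variable [IsLocalRing V] {g : Fq →+* ResidueField V}

theorem isUnit_of_residue_ne_zero {y : V} (hy : residue V y ≠ 0) : IsUnit y := by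
  rwa [Ne, residue_eq_zero_iff, mem_maximalIdeal, mem_nonunits_iff, not_not] at hy

/-- A value with vanishing reduction is divisible by `p`. -/
theorem dvd_torusEval (hr : ∀ a, r a = 0 → (p : A) ∣ a) (G : MvPolynomial (Fin n) A)
    {x : Fin n → Vˣ} {k : ℕ} (hk : 0 < k) (hx : x ^ Nat.card Fq ^ k = x)
    (h0 : residue V (torusEval (map j G) x) = 0) : (p : V) ∣ torusEval (map j G) x := by
  -- A zero residue alone need not give divisibility by p. Periodicity does: p divides y^(q^k) - y,
  -- which is y times a unit when y reduces to 0.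
  have h := dvd_torusEval_pow_pow_sub (j := j) hr G x k
  rw [hx] at h
  set y := torusEval (map j G) x
  have hM : 1 < Nat.card Fq ^ k := Nat.one_lt_pow hk.ne' Finite.one_lt_card
  obtain ⟨M, hM'⟩ : ∃ M, Nat.card Fq ^ k = M + 1 + 1 := ⟨Nat.card Fq ^ k - 2, by omega⟩
  rw [hM', pow_succ, show y ^ (M + 1) * y - y = (y ^ (M + 1) - 1) * y by ring] at h
  refine (IsUnit.dvd_mul_left (isUnit_of_residue_ne_zero ?_)).mp h
  rw [map_sub, map_pow, h0, zero_pow (Nat.succ_ne_zero _)]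
  simp

/-- The exponent is large enough: (q - 1) p^(m-1) ≥ m. -/
theorem pow_dvd_torusEval_pow [Fact p.Prime] (hr : ∀ a, r a = 0 → (p : A) ∣ a) (G : MvPolynomial (Fin n) A)
    {x : Fin n → Vˣ} {k : ℕ} (hk : 0 < k) (hx : x ^ Nat.card Fq ^ k = x)
    (h0 : residue V (torusEval (map j G) x) = 0) {m : ℕ} (hm : 0 < m) :
    (p : V) ^ m ∣ torusEval (map j G) x ^ ((Nat.card Fq - 1) * p ^ (m - 1)) := by
  refine (pow_dvd_pow_of_dvd (dvd_torusEval hr G hk hx h0) m).trans (pow_dvd_pow _ ?_)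
  have h1 : m - 1 < p ^ (m - 1) := Nat.lt_pow_self (Fact.out : p.Prime).one_lt
  have h2 : 1 ≤ Nat.card Fq - 1 := Nat.le_sub_one_of_lt Finite.one_lt_card
  calc m ≤ 1 * p ^ (m - 1) := by omega
    _ ≤ _ := Nat.mul_le_mul_right _ h2

/-- Modulo p, raising to the power q permutes the factors cyclically, so the product Y satisfies Y^q
≡ Y. As Y is a unit, Y^(q-1) ≡ 1 modulo p, and the p^(m-1)-th power improves this to p^m. Single
factors need not satisfy this; only the product over a closed orbit does. -/
theorem pow_dvd_prod_torusEval_pow_sub_one (hr : ∀ a, r a = 0 → (p : A) ∣ a)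
    (hp : residue V (p : V) = 0) (G : MvPolynomial (Fin n) A)
    {x : Fin n → Vˣ} {k : ℕ} (hx : x ^ Nat.card Fq ^ k = x)
    (h0 : residue V (torusEval (map j G) x) ≠ 0) {m : ℕ} (hm : 0 < m) :
    (p : V) ^ m ∣ (∏ i ∈ Finset.range k, torusEval (map j G) (x ^ Nat.card Fq ^ i)) ^
      ((Nat.card Fq - 1) * p ^ (m - 1)) - 1 := by
  set y : ℕ → V := fun i => torusEval (map j G) (x ^ Nat.card Fq ^ i) with hy
  have hres : ∀ i, residue V (y i) ≠ 0 := by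
    intro i
    have h := map_dvd (residue V) (dvd_torusEval_pow_pow_sub (j := j) hr G x i)
    rw [hp, zero_dvd_iff, map_sub, map_pow, sub_eq_zero] at h
    rw [hy, ← h]
    exact pow_ne_zero _ h0
  have hshift : ∏ i ∈ Finset.range k, y (i + 1) = ∏ i ∈ Finset.range k, y i := by
    rcases k with _ | k
    · rfl
    · rw [Finset.prod_range_succ, Finset.prod_range_succ']
      congr 1
      simp only [hy, hx, pow_zero, pow_one]
  have hstep : (p : V) ∣ (∏ i ∈ Finset.range k, y i) ^ Nat.card Fq - ∏ i ∈ Finset.range k, y i := by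
    nth_rewrite 2 [← hshift]
    rw [← Ideal.mem_span_singleton, ← Ideal.Quotient.mk_eq_mk_iff_sub_mem, map_pow, map_prod,
      map_prod, ← Finset.prod_pow]
    refine Finset.prod_congr rfl fun i _ => ?_
    rw [← map_pow, Ideal.Quotient.mk_eq_mk_iff_sub_mem, Ideal.mem_span_singleton]
    simp only [hy, pow_succ _ i, pow_mul]
    exact dvd_torusEval_pow_sub hr G _
  have hu : residue V (∏ i ∈ Finset.range k, y i) ≠ 0 := by
    rw [map_prod, Finset.prod_ne_zero_iff]
    exact fun i _ => hres i
  set Y := ∏ i ∈ Finset.range k, y i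
  have h1 : (p : V) ∣ Y ^ (Nat.card Fq - 1) - 1 := by
    obtain ⟨q, hq⟩ := Nat.exists_eq_succ_of_ne_zero (Nat.card_pos (α := Fq)).ne'
    rw [hq, pow_succ, show Y ^ q * Y - Y = Y * (Y ^ q - 1) by ring] at hstep
    rw [hq]
    exact (IsUnit.dvd_mul_left (isUnit_of_residue_ne_zero hu)).mp hstep
  have h2 := dvd_sub_pow_of_dvd_sub h1 (m - 1)
  rwa [Nat.sub_add_cancel hm, one_pow, ← pow_mul] at h2

/-- Modulo `p ^ m`, the weights given by the powers of a lift of `f` are those of the indicator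
function of the complement of `f = 0`. -/
theorem mk_trajProd_eq [Fact p.Prime] (hr : ∀ a, r a = 0 → (p : A) ∣ a) (hp : residue V (p : V) = 0)
    (hg : ∀ a, residue V (j a) = g (r a)) (G : MvPolynomial (Fin n) A)
    {m : ℕ} (hm : 0 < m) (x : Fin n → Vˣ) {k : ℕ} (hk : 0 < k)
    (hx : (powMap V n (Nat.card Fq))^[k] x = x) :
    Ideal.Quotient.mk (Ideal.span {(p : V) ^ m}) (trajProd (powMap V n (Nat.card Fq))
      (fun x => eval (fun i => (x i : V)) (map j G ^ ((Nat.card Fq - 1) * p ^ (m - 1)))) k x) =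
    Int.castRingHom _
      (trajProd (powMap V n (Nat.card Fq)) (unitIndicator (map g (map r G))) k x) := by
  classical
  rw [powMap_iterate] at hx
  have h1 : trajProd (powMap V n (Nat.card Fq))
      (fun x => eval (fun i => (x i : V)) (map j G ^ ((Nat.card Fq - 1) * p ^ (m - 1)))) k x =
      (∏ i ∈ Finset.range k, torusEval (map j G) (x ^ Nat.card Fq ^ i)) ^
        ((Nat.card Fq - 1) * p ^ (m - 1)) := by
    simp only [trajProd, powMap_iterate, map_pow, Finset.prod_pow, torusEval]
  rw [h1, trajProd_unitIndicator g _ x hk, unitIndicator_eq, ← residue_torusEval hg G x]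
  split_ifs with h0
  · rw [map_zero, Ideal.Quotient.eq_zero_iff_mem, Ideal.mem_span_singleton, ← Finset.prod_pow]
    refine Dvd.dvd.trans ?_ (Finset.dvd_prod_of_mem _ (Finset.mem_range.mpr hk))
    rw [pow_zero, pow_one]
    exact pow_dvd_torusEval_pow hr G hk hx h0 hm
  · rw [map_one, ← map_one (Ideal.Quotient.mk _), Ideal.Quotient.mk_eq_mk_iff_sub_mem,
      Ideal.mem_span_singleton]
    exact pow_dvd_prod_torusEval_pow_sub_one hr hp G hx h0 hm

end Congruence
end WanZeta

namespace WanZeta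
open MvPolynomial IsLocalRing

/-! ### The alternating product of determinants -/

section Product

variable {B : Type*} [CommRing B]

theorem constantCoeff_zpow_eq_one {u : (PowerSeries B)ˣ}
    (hu : PowerSeries.constantCoeff (u : PowerSeries B) = 1) (z : ℤ) :
    PowerSeries.constantCoeff ((u ^ z : (PowerSeries B)ˣ) : PowerSeries B) = 1 := by
  have h : Units.map (PowerSeries.constantCoeff (R := B)).toMonoidHom u = 1 := Units.ext hu
  have h2 := map_zpow (Units.map (PowerSeries.constantCoeff (R := B)).toMonoidHom) u z
  rw [h, one_zpow] at h2
  exact congrArg Units.val h2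

theorem constantCoeff_prod_eq_one {ι : Type*} (s : Finset ι) {u : ι → (PowerSeries B)ˣ}
    (hu : ∀ i, PowerSeries.constantCoeff (u i : PowerSeries B) = 1) :
    PowerSeries.constantCoeff ((∏ i ∈ s, u i : (PowerSeries B)ˣ) : PowerSeries B) = 1 := by
  rw [Units.coe_prod, map_prod]
  exact Finset.prod_eq_one fun i _ => hu i

/-- The alternating product of the determinants `det (I - q ^ i M T)`. -/
def altProd {ι : Type*} [Fintype ι] [DecidableEq ι] (n q : ℕ) (M : Matrix ι ι B) :
    (PowerSeries B)ˣ :=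
  ∏ i ∈ Finset.range (n + 1),
    charpolyRevUnit ((q : B) ^ i • M) ^ ((-1 : ℤ) ^ i * (n.choose i : ℤ))

theorem constantCoeff_altProd {ι : Type*} [Fintype ι] [DecidableEq ι] (n q : ℕ)
    (M : Matrix ι ι B) : PowerSeries.constantCoeff (altProd n q M : PowerSeries B) = 1 :=
  constantCoeff_prod_eq_one _ fun _ => constantCoeff_zpow_eq_one (constantCoeff_charpolyRev _) _

theorem mapUnits_altProd {C : Type*} [CommRing C] {ι : Type*} [Fintype ι] [DecidableEq ι]
    (α : B →+* C) (n q : ℕ) (M : Matrix ι ι B) :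
    mapUnits α (altProd n q M) = altProd n q (M.map α) := by
  rw [altProd, map_prod]
  refine Finset.prod_congr rfl fun i _ => ?_
  rw [map_zpow, mapUnits_charpolyRevUnit]
  congr 2
  ext1
  simp

/-- The factor (1 - q^k)^n is the binomial sum of (-1)^i (n choose i) q^(ik), where q^(ik) comes
from the trace of (q^i M)^k. -/
theorem logD_altProd {ι : Type*} [Fintype ι] [DecidableEq ι] (n q : ℕ) (M : Matrix ι ι B) :
    logD (altProd n q M) = -posSeries fun k => (1 - (q : B) ^ k) ^ n * (M ^ k).trace := by
  rw [altProd, logD_prod]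
  ext k
  simp only [logD_zpow, logD_charpolyRevUnit, map_sum, map_zsmul, map_neg, posSeries,
    PowerSeries.coeff_mk]
  split_ifs
  · simp
  · rw [sub_eq_neg_add, add_pow, Finset.sum_mul, ← Finset.sum_neg_distrib]
    refine Finset.sum_congr rfl fun i _ => ?_
    rw [smul_pow, Matrix.trace_smul, zsmul_eq_mul, smul_eq_mul]
    push_cast
    rw [neg_pow ((q : B) ^ k), one_pow, ← pow_mul, ← pow_mul, mul_comm i k]
    ring

end Product

/-! ### Integrality and the congruence over V -/

section Main

variable {p : ℕ} [Fact p.Prime] {Fq : Type*} [Field Fq] [Finite Fq] {n : ℕ}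

/-- Integrality comes from the Euler product for the integer-valued indicator weight; over ℚ, equal
logarithmic derivatives and constant term 1 identify it with the exponential. -/
theorem exists_integral_zeta [CharP Fq p] {V : Type*} [CommRing V] [IsDomain V] [IsLocalRing V]
    (g : Fq →+* ResidueField V) (hroots : ∀ M > 0, ∃ ζ : V, IsPrimitiveRoot ζ M)
    (f : MvPolynomial (Fin n) Fq) :
    ∃ Z : (PowerSeries ℤ)ˣ, PowerSeries.constantCoeff (Z : PowerSeries ℤ) = 1 ∧
      logD Z = posSeries (orbitSum (powMap V n (Nat.card Fq)) (zeroIndicator (map g f))) ∧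
      PowerSeries.map (Int.castRingHom ℚ) Z = zetaOfCounts (hypersurfaceCount p f) := by
  obtain ⟨Z, hZ0, hZ⟩ := exists_logD_eq_orbitSum (φ := powMap V n (Nat.card Fq))
    (fun k hk => finite_ptsOfPeriod_powMap Finite.one_lt_card hk) (zeroIndicator (map g f))
  refine ⟨Z, hZ0, hZ, ?_⟩
  obtain ⟨h0, hlog⟩ := logD_zetaOfCounts (hypersurfaceCount p f)
  have hu : IsUnit (zetaOfCounts (hypersurfaceCount p f)) := by
    rw [PowerSeries.isUnit_iff_constantCoeff, h0]
    exact isUnit_one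
  have hmap0 : PowerSeries.constantCoeff (mapUnits (Int.castRingHom ℚ) Z : PowerSeries ℚ) = 1 := by
    have : PowerSeries.constantCoeff (PowerSeries.map (Int.castRingHom ℚ) (Z : PowerSeries ℤ)) = 1 := by
      rw [← PowerSeries.coeff_zero_eq_constantCoeff_apply, PowerSeries.coeff_map,
        PowerSeries.coeff_zero_eq_constantCoeff_apply, hZ0, map_one]
    exact this
  have hL : logD (mapUnits (Int.castRingHom ℚ) Z) = posSeries fun k =>
      ((orbitSum (powMap V n (Nat.card Fq)) (zeroIndicator (map g f)) k : ℤ) : ℚ) := by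
    rw [logD_map, hZ]
    ext k
    simp only [posSeries, PowerSeries.coeff_map, PowerSeries.coeff_mk]
    split_ifs <;> simp
  have h := eq_of_logD_eq (u := mapUnits (Int.castRingHom ℚ) Z) (v := hu.unit) hmap0 h0 <| by
    rw [hL, hlog hu.unit rfl]
    intro k
    rw [orbitSum_zeroIndicator (p := p) g hroots f k]
    simp
  exact congrArg Units.val h

/-- The congruence for the complement of a hypersurface in the torus, over a local domain that
contains all roots of unity. -/
theorem map_zeta_eq_map_altProd {A V : Type*} [CommRing A] [CommRing V] [IsDomain V] [CharZero V]
    [IsLocalRing V] {r : A →+* Fq} {j : A →+* V} {g : Fq →+* ResidueField V}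
    (hroots : ∀ M > 0, ∃ ζ : V, IsPrimitiveRoot ζ M)
    (hr : ∀ a, r a = 0 → (p : A) ∣ a) (hp : residue V (p : V) = 0)
    (hg : ∀ a, residue V (j a) = g (r a)) {m : ℕ} (hm : 0 < m) {d : ℕ}
    {G : MvPolynomial (Fin n) A} (hG : G.totalDegree ≤ d) {ZU : (PowerSeries ℤ)ˣ}
    (hZU0 : PowerSeries.constantCoeff (ZU : PowerSeries ℤ) = 1)
    (hZU : logD ZU =
      posSeries (orbitSum (powMap V n (Nat.card Fq)) (unitIndicator (map g (map r G))))) :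
    mapUnits (Int.castRingHom (V ⧸ Ideal.span {(p : V) ^ m})) ZU ^ (-(-1 : ℤ) ^ n) =
      mapUnits (Ideal.Quotient.mk (Ideal.span {(p : V) ^ m})) (altProd n (Nat.card Fq)
        (opMat (Nat.card Fq) (d * p ^ (m - 1))
          (map j G ^ ((Nat.card Fq - 1) * p ^ (m - 1))))) := by
  set q := Nat.card Fq with hq
  set H := map j G ^ ((q - 1) * p ^ (m - 1)) with hH
  have hHdeg : H.totalDegree ≤ (q - 1) * (d * p ^ (m - 1)) := by
    refine (totalDegree_pow _ _).trans ?_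
    calc _ ≤ ((q - 1) * p ^ (m - 1)) * d := Nat.mul_le_mul_left _ ((Finset.sup_mono (support_map_subset _ _)).trans hG)
      _ = _ := by ring
  set D := altProd n q (opMat q (d * p ^ (m - 1)) H) with hD
  have hq1 : 1 < q := Finite.one_lt_card
  -- The exponent converts -(1 - q^k)^n into the factor (q^k - 1)^n of the trace formula.
  have hlog : logD (D ^ (-(-1 : ℤ) ^ n)) =
      posSeries (orbitSum (powMap V n q) fun x => eval (fun i => (x i : V)) H) := by
    rw [logD_zpow, hD, logD_altProd]
    ext k
    simp only [map_zsmul, map_neg, posSeries, PowerSeries.coeff_mk]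
    split_ifs with hk
    · simp
    · have hcard : Nat.card (rootsOfUnity (q ^ k - 1) V) = q ^ k - 1 := by
        have hM0 : 0 < q ^ k - 1 := Nat.sub_pos_of_lt (Nat.one_lt_pow hk hq1)
        have : NeZero (q ^ k - 1) := ⟨hM0.ne'⟩
        obtain ⟨ζ, hζ⟩ := hroots _ hM0
        exact hζ.card_rootsOfUnity
      rw [orbitSum_powMap hq1 hHdeg (Nat.pos_of_ne_zero hk) hcard, zsmul_eq_mul]
      push_cast
      rw [neg_mul_neg, ← mul_assoc, ← mul_pow]
      ring
  have hcong := mapUnits_eq_of_trajProd_eq (φ := powMap V n q)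
    (fun k hk => finite_ptsOfPeriod_powMap hq1 hk) (Ideal.Quotient.mk (Ideal.span {(p : V) ^ m}))
    (Int.castRingHom _) (fun x k hk hx => mk_trajProd_eq hr hp hg G hm x hk hx)
    (constantCoeff_zpow_eq_one (constantCoeff_altProd n q _) _) hZU0 hlog hZU
  rw [← hcong, ← map_zpow, ← zpow_mul, neg_mul_neg, ← mul_pow, neg_mul_neg, one_mul, one_pow,
    zpow_one]

end Main

/-! ### Descent from V/(p^m) to O_m -/

theorem pow_dvd_of_pow_dvd_map {A V : Type*} [CommRing A] [CommRing V] [IsDomain V] [CharZero V]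
    (j : A →+* V) {p : ℕ} (hp : p ≠ 0) (hdvd : ∀ a, (p : V) ∣ j a → (p : A) ∣ a) (m : ℕ) (a : A)
    (h : (p : V) ^ m ∣ j a) : (p : A) ^ m ∣ a := by
  induction m generalizing a with
  | zero => simp
  | succ m ih =>
    obtain ⟨b, rfl⟩ := hdvd a ((dvd_pow_self _ m.succ_ne_zero).trans h)
    rw [pow_succ']
    refine mul_dvd_mul_left _ (ih b ?_)
    rw [map_mul, map_natCast, pow_succ'] at h
    exact (mul_dvd_mul_iff_left (Nat.cast_ne_zero.mpr hp)).mp h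

theorem mapUnits_injective {B C : Type*} [CommRing B] [CommRing C] {α : B →+* C}
    (hα : Function.Injective α) : Function.Injective (mapUnits α) :=
  Units.map_injective fun u v h => PowerSeries.ext fun i => hα <| by
    have := congrArg (PowerSeries.coeff i) h
    simpa using this

theorem mapUnits_mapUnits {B C D : Type*} [CommRing B] [CommRing C] [CommRing D] (α : B →+* C)
    (β : C →+* D) (u : (PowerSeries B)ˣ) :
    mapUnits β (mapUnits α u) = mapUnits (β.comp α) u := by
  ext1
  ext i
  simp

/-- Two lifts of a polynomial modulo `p` have the same `p ^ (m - 1)`-th powers modulo `p ^ m`. -/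
theorem pow_eq_pow_of_map_eq {O k : Type*} [CommRing O] [CommRing k] {n p m : ℕ} (hm : 0 < m)
    {ρ : O →+* k} (hρ : ∀ a, ρ a = 0 → (p : O) ∣ a) (hp : (p : O) ^ m = 0)
    {F G : MvPolynomial (Fin n) O} (h : map ρ F = map ρ G) : F ^ p ^ (m - 1) = G ^ p ^ (m - 1) := by
  have h1 := dvd_sub_pow_of_dvd_sub
    (natCast_dvd_of_map_eq_zero hρ (G := F - G) (by rw [map_sub, h, sub_self])) (m - 1)
  rwa [Nat.sub_add_cancel hm, ← map_natCast (C (σ := Fin n) (R := O)), ← map_pow, hp, map_zero,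
    zero_dvd_iff, sub_eq_zero] at h1

end WanZeta

end

set_option maxHeartbeats 1000000 in
theorem theorem5p2 (p : ℕ) [Fact p.Prime]
    (K : Type*) [Field K] [Algebra ℚ_[p] K] [FiniteDimensional ℚ_[p] K]
    [Algebra ℤ_[p] K] [IsScalarTower ℤ_[p] ℚ_[p] K]
    (Fq : Type*) [Field Fq] [Finite Fq] [CharP Fq p]
    -- `K` is unramified with residue field `Fq`: `p` generates the maximal ideal of `O_K`
    (e : (WanZeta.IntegerRing p K ⧸ Ideal.span {(p : WanZeta.IntegerRing p K)}) ≃+* Fq)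
    (n m : ℕ) (hm : 0 < m)
    (f : MvPolynomial (Fin n) Fq)
    (F : MvPolynomial (Fin n) (WanZeta.ResidueRing p K m))
    (hF : MvPolynomial.map (WanZeta.reduction e hm) F = f) :
    -- the two zeta functions are invertible power series with integer coefficients
    ∃ ZX ZG : (PowerSeries ℤ)ˣ,
      PowerSeries.map (Int.castRingHom ℚ) ZX =
        WanZeta.zetaOfCounts (WanZeta.hypersurfaceCount p f) ∧
      PowerSeries.map (Int.castRingHom ℚ) ZG =
        WanZeta.zetaOfCounts (WanZeta.torusCount p Fq n) ∧
      -- the congruence modulo `p ^ m`, as an equality in the units of `O_m[[T]]`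
      Units.map (PowerSeries.map (Int.castRingHom (WanZeta.ResidueRing p K m))).toMonoidHom
          ((ZX / ZG) ^ ((-1 : ℤ) ^ n)) =
        ∏ i ∈ Finset.range (n + 1),
          WanZeta.detFactor F (WanZeta.psiMul_stable e hm hF) i ^
            ((-1 : ℤ) ^ i * (n.choose i : ℤ)) := by
  classical
  open WanZeta MvPolynomial IsLocalRing in
  have : CharZero K := charZero_of_injective_algebraMap (algebraMap ℚ_[p] K).injective
  have : CharZero (IntegerRing p K) := RingHom.charZero (algebraMap (IntegerRing p K) K)
  have hpA : ¬IsUnit (p : IntegerRing p K) := by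
    rw [← Ideal.span_singleton_eq_top]
    intro h
    have := Ideal.Quotient.subsingleton_iff.mpr h
    exact not_subsingleton Fq e.symm.toEquiv.subsingleton
  let r : IntegerRing p K →+* Fq := e.toRingHom.comp (Ideal.Quotient.mk _)
  have hr : ∀ a, r a = 0 → (p : IntegerRing p K) ∣ a := by
    intro a ha
    rwa [← Ideal.mem_span_singleton, ← Ideal.Quotient.eq_zero_iff_mem,
      ← map_eq_zero_iff e e.injective]
  have hsurj : Function.Surjective r := e.surjective.comp Ideal.Quotient.mk_surjective
  obtain ⟨V, j, _, hpV, hroots⟩ := exists_local_extension hpA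
  have hpres : residue V (p : V) = 0 := (residue_eq_zero_iff _).mpr hpV
  let g : Fq →+* ResidueField V :=
    (Ideal.Quotient.lift (Ideal.span {(p : IntegerRing p K)}) ((residue V).comp j) (by
      intro a ha
      obtain ⟨b, rfl⟩ := Ideal.mem_span_singleton.mp ha
      rw [map_mul, RingHom.comp_apply, map_natCast, hpres, zero_mul])).comp e.symm.toRingHom
  have hg : ∀ a, residue V (j a) = g (r a) := by
    intro a
    simp [g, r]
  -- Unramifiedness enters here: p generates the kernel of `r`, and `g` is injective because its
  -- source is a field.
  have hdvd : ∀ a, (p : V) ∣ j a → (p : IntegerRing p K) ∣ a := by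
    rintro a ⟨b, hb⟩
    apply hr
    rw [← map_eq_zero_iff g g.injective, ← hg, hb, map_mul, hpres, zero_mul]
  let β : ResidueRing p K m →+* V ⧸ Ideal.span {(p : V) ^ m} :=
    Ideal.quotientMap _ j (by
      rw [Ideal.span_singleton_le_iff_mem, Ideal.mem_comap, map_pow, map_natCast]
      exact Ideal.mem_span_singleton_self _)
  have hβ : Function.Injective β := by
    refine Ideal.quotientMap_injective' ?_
    intro a ha
    rw [Ideal.mem_comap, Ideal.mem_span_singleton] at ha
    rw [Ideal.mem_span_singleton]
    exact pow_dvd_of_pow_dvd_map j (Fact.out : p.Prime).ne_zero hdvd m a ha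
  obtain ⟨G, hGf, hGd⟩ := exists_map_eq_totalDegree_le hsurj f
  have hred : (reduction e hm).comp (Ideal.Quotient.mk _) = r := RingHom.ext fun _ => rfl
  -- The lift F may have degree larger than d; only its p^(m-1)-th power enters the operator, so G
  -- can replace it.
  have hpow : F ^ p ^ (m - 1) = map (Ideal.Quotient.mk _) G ^ p ^ (m - 1) :=
    pow_eq_pow_of_map_eq hm (dvd_of_reduction_eq_zero e hm) (natCast_pow_eq_zero p K m) <| by
      rw [hF, map_map, hred, hGf]
  obtain ⟨ZX, hZX0, hZX, hZXmap⟩ := exists_integral_zeta (p := p) g hroots f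
  obtain ⟨ZG, hZG0, hZG, hZGmap⟩ :=
    exists_integral_zeta (p := p) g hroots (0 : MvPolynomial (Fin n) Fq)
  obtain ⟨ZU, hZU0, hZU⟩ := exists_logD_eq_orbitSum (φ := powMap V n (Nat.card Fq))
    (fun k hk => finite_ptsOfPeriod_powMap Finite.one_lt_card hk) (unitIndicator (map g f))
  have hprod : ZU * ZX = ZG := by
    refine eq_of_logD_eq ?_ hZG0 ?_
    · rw [Units.val_mul, map_mul, hZU0, hZX0, one_mul]
    · rw [logD_mul, hZU, hZX, hZG]
      ext k
      simp only [map_add, posSeries, PowerSeries.coeff_mk]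
      split_ifs with hk
      · simp
      · exact orbitSum_unitIndicator g f (Nat.pos_of_ne_zero hk)
  -- It suffices to compare both sides over V/(p^m).
  refine ⟨ZX, ZG, hZXmap, ?_, mapUnits_injective hβ ?_⟩
  · rw [hZGmap]
    exact congrArg _ (funext fun k => hypersurfaceCount_zero n k)
  have hquot : (ZX / ZG) ^ ((-1 : ℤ) ^ n) = ZU ^ (-(-1 : ℤ) ^ n) := by
    rw [← hprod, div_mul_cancel_right, inv_zpow, zpow_neg]
  have hcomp : β.comp (Int.castRingHom (ResidueRing p K m)) = Int.castRingHom _ :=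
    RingHom.ext_int _ _
  have : Nontrivial (ResidueRing p K m) := (reduction e hm).domain_nontrivial
  have hβmk : β.comp (Ideal.Quotient.mk _) = (Ideal.Quotient.mk _).comp j :=
    RingHom.ext fun _ => rfl
  have hrhs : ∏ i ∈ Finset.range (n + 1), detFactor F (psiMul_stable e hm hF) i ^
      ((-1 : ℤ) ^ i * (n.choose i : ℤ)) = altProd n (Nat.card Fq)
        (opMat (Nat.card Fq) (f.totalDegree * p ^ (m - 1))
          (F ^ ((Nat.card Fq - 1) * p ^ (m - 1)))) :=
    Finset.prod_congr rfl fun i _ => by rw [detFactor_eq Nat.card_pos]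
  subst hGf
  rw [hrhs]
  change mapUnits β (mapUnits _ _) = _
  rw [mapUnits_mapUnits, hcomp, hquot, map_zpow,
    map_zeta_eq_map_altProd hroots hr hpres hg hm hGd hZU0 hZU, mapUnits_altProd, mapUnits_altProd,
    opMat_map, opMat_map, mul_comm (Nat.card Fq - 1), pow_mul, pow_mul, hpow]
  simp only [map_pow, map_map, hβmk]
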